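/- Let $A$ be a semilocal commutative ring, that is, a ring with only finitely many maximal ideals. Let $d > 0$, let $U \subset \mathbb{A}^d_A$ be an open subscheme whose fiber over every point of $\operatorname{Spec}(A)$ is nonempty, and let $Z$ be a finite $A$-scheme. For a maximal ideal $\mathfrak{m} \subset A$, write $k_\mathfrak{m}$ for its residue field, and for a point $z$ of a scheme write $k_z$ for its residue field. One says that there is no finite field obstruction to embedding $Z$ into $U$ if for each maximal ideal $\mathfrak{m} \subset A$ with $k_\mathfrak{m}$ finite, \[ \#\{ z \in Z_{k_\mathfrak{m}} \mid [k_z : k_\mathfrak{m}] = m \} \le \#\{ z \in U_{k_\mathfrak{m}} \mid [k_z : k_\mathfrak{m}] = m \} \quad \text{for every } m \ge 1. \] (a) There is a closed immersion $\iota \colon Z \hookrightarrow U$ of $A$-schemes if and only if there is no finite field obstruction to embedding $Z$ into $U$ and $Z$ is a closed subscheme (over $A$) of some affine $A$-scheme $C$ that is smooth of relative dimension $d$ over $A$. (b) Suppose that there is no finite field obstruction to embedding $Z$ into $U$, and let $Z \subset C$ be any closed subscheme inclusion over $A$ with $C$ affine and smooth of relative dimension $d$ over $A$. Then $\iota$ may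 be chosen to be excisive: there are an affine open $D \subset C$ containing $Z$, an étale $A$-morphism $f \colon D \to U$, a closed subscheme $Z' \subset U$, and a Cartesian square \[ \begin{array}{ccc} Z & \hookrightarrow & D \\ {\scriptstyle\sim}\downarrow & & \downarrow{\scriptstyle f} \\ Z' & \hookrightarrow & U \end{array} \] whose left vertical map is an isomorphism and whose horizontal maps are the inclusions; in particular, $f$ embeds $Z$ as the closed subscheme $Z' \subset U$. Moreover, for every closed subscheme $Y \subset Z$ (which is automatically finite over $A$) and every closed immersion $\iota_Y \colon Y \hookrightarrow U$ of $A$-schemes, there are such $D$ and $f$ with, in addition, $f|_Y = \iota_Y$. -/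

import Mathlib

open CategoryTheory CategoryTheory.Limits AlgebraicGeometry

universe u

/-- Affine `d`-space `𝔸^d_A` over a commutative ring `A`. -/
noncomputable abbrev affineSpaceOver (d : ℕ) (A : Type u) [CommRing A] : Scheme.{u} :=
  AffineSpace (ULift.{u} (Fin d)) (Spec (CommRingCat.of A))

/-- The structure morphism `𝔸^d_A ⟶ Spec A`. -/
noncomputable abbrev affineSpaceToBase (d : ℕ) (A : Type u) [CommRing A] :
    affineSpaceOver d A ⟶ Spec (CommRingCat.of A) :=
  AffineSpace (ULift.{u} (Fin d)) (Spec (CommRingCat.of A)) ↘ Spec (CommRingCat.of A)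

/-- The structure morphism `U ⟶ Spec A` of an open subscheme `U ⊆ 𝔸^d_A`. -/
noncomputable abbrev openToBase {d : ℕ} {A : Type u} [CommRing A]
    (U : (affineSpaceOver d A).Opens) : U.toScheme ⟶ Spec (CommRingCat.of A) :=
  U.ι ≫ affineSpaceToBase d A

/-- The closed point of `Spec A` given by a maximal ideal of `A`. -/
def closedPointOf {A : Type u} [CommRing A] (m : MaximalSpectrum A) :
    Spec (CommRingCat.of A) :=
  m.toPrimeSpectrum

/-- For a scheme `X` over `S` and a point `s` of `S`, the points `x` of the fibre `X_{k_s}`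
such that `[k_x : k_s] = n`. For `n ≥ 1` only finite residue field extensions are counted. -/
def fibrePointsOfDegree {X S : Scheme.{u}} (g : X ⟶ S) (s : S) (n : ℕ) : Set (g.fiber s) :=
  {x | (g.fiberToSpecResidueField s).residueDegree x = n}

/-- There is no finite field obstruction to embedding the `A`-scheme `Z` into the `A`-scheme `X`:
for every maximal ideal `m` of `A` with finite residue field `k_m` and every `n ≥ 1`, the fibre
`Z_{k_m}` has at most as many points of degree `n` over `k_m` as the fibre `X_{k_m}`. -/
def NoFiniteFieldObstruction {A : Type u} [CommRing A] {Z X : Scheme.{u}}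
    (z : Z ⟶ Spec (CommRingCat.of A)) (x : X ⟶ Spec (CommRingCat.of A)) : Prop :=
  ∀ m : MaximalSpectrum A,
    Finite ((Spec (CommRingCat.of A)).residueField (closedPointOf m)) →
      ∀ n : ℕ, 1 ≤ n →
        (fibrePointsOfDegree z (closedPointOf m) n).encard ≤
          (fibrePointsOfDegree x (closedPointOf m) n).encard

/-- Let `j : Z ⟶ C` be the inclusion of a closed subscheme and let `D ⊆ C` be an open.
The morphism `f : D ⟶ U` embeds `Z` excisively, with `k : Z ⟶ D` the inclusion: `Z` lies in `D`
and there are a closed subscheme `Z' ⊆ U` and a Cartesian square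
```
Z  --k-->  D
|≅         | f
Z' ----->  U
``` -/
def IsExcisiveEmbedding {Z C U : Scheme.{u}} (j : Z ⟶ C) (D : C.Opens)
    (k : Z ⟶ D.toScheme) (f : D.toScheme ⟶ U) : Prop :=
  k ≫ D.ι = j ∧
    ∃ (Z' : Scheme.{u}) (i' : Z' ⟶ U) (e : Z ≅ Z'),
      IsClosedImmersion i' ∧ IsPullback k e.hom f i'

/-! Write C = Spec R and Z = Spec R/I. A map C → 𝔸^d over A is a d-tuple a in R, and everything
rests on conditions on a at the closed points of Z, which are finite in number because A is
semilocal. Since Ω is locally free of rank d, the map is étale at such a point once the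
differentials of the a i span Ω there (`MvPolynomial.isEtaleAt_of_span_range_D_sup_smul_eq_top`). By
Nakayama its restriction to Z is a closed immersion once it is also injective on closed points with
trivial residue field extensions (`Ideal.Quotient.algebraMap_surjective_of_forall_isMaximal`).

The images of the closed points are chosen first (`exists_injective_mem_pointsWithResidueField`).
Over an infinite k_m, a residue field L of Z satisfies dim Ω_{L/k_m} ≤ d, so it is generated by d
elements; translating the generators produces points of U with residue field L outside any
prescribed finite set. Over a finite k_m, the field L is determined by its cardinality, and the
absence of an obstruction says there are enough points. The Chinese remainder theorem then gives a
tuple with the chosen values at the points and the prescribed restriction to Y. It can still be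
changed by the ideal of functions vanishing at those points and on Y. Together with the tuple's own
differentials, the differentials of these functions span Ω at each point, so a suitable change makes
the tuple's differentials span by themselves (`Derivation.exists_span_range_D_add_eq_top`).

For excision, Z is a section of the étale map f⁻¹(Z') → Z', hence open in f⁻¹(Z'), and the closed
rest of f⁻¹(Z') is removed (`exists_isPullback_of_etale`). Conversely, an immersion preserves
residue fields, so it bounds the counts; and a finite Z in U is closed in 𝔸^d, so a basic open of
𝔸^d inside U serves as C. -/

/-! ### Generating finite field extensions by few elements -/

section FieldTheory

open KaehlerDifferential IntermediateField

/-- If the differentials of `T` span `Ω[L⁄k]` and the `k`-embeddings of `L` are separated by some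
element of `T`, then `T` generates `L` over `k`. -/
lemma IntermediateField.adjoin_eq_top_of_span_D_eq_top {k L : Type*} [Field k] [Field L]
    [Algebra k L] [FiniteDimensional k L] (T : Set L)
    (hT : Submodule.span L (D k L '' T) = ⊤) (α : L) (hα : α ∈ T)
    (h : Function.Injective fun φ : L →ₐ[k] AlgebraicClosure L ↦ φ α) :
    adjoin k T = ⊤ := by
  set E := adjoin k T
  -- Ω[L/E] is a quotient of Ω[L/k] in which the generators D t, t ∈ T, die. So L/E is separable,
  -- and α is a primitive element already lying in E.
  have h0 : Subsingleton (Ω[L⁄E]) := by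
    rw [← Submodule.subsingleton_iff L, ← subsingleton_iff_bot_eq_top]
    rw [← LinearMap.range_eq_top.mpr (KaehlerDifferential.map_surjective k E L),
      LinearMap.range_eq_map, ← hT, Submodule.map_span, eq_comm, Submodule.span_eq_bot]
    rintro _ ⟨_, ⟨t, ht, rfl⟩, rfl⟩
    rw [KaehlerDifferential.map_D]
    exact (D E L).map_algebraMap (⟨t, subset_adjoin k T ht⟩ : E)
  have : Algebra.FormallyUnramified E L := ⟨h0⟩
  have : Algebra.IsSeparable E L := Algebra.FormallyUnramified.isSeparable E L
  have h1 : E⟮α⟯ = ⊤ := by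
    rw [Field.primitive_element_iff_algHom_eq_of_eval' E (AlgebraicClosure L)
      (fun x ↦ IsAlgClosed.splits _)]
    intro φ ψ hφ
    have := @h (φ.restrictScalars k) (ψ.restrictScalars k) hφ
    ext x
    exact DFunLike.congr_fun this x
  have h2 : E⟮α⟯ = ⊥ := by
    rw [adjoin_simple_eq_bot_iff, mem_bot]
    exact ⟨⟨α, subset_adjoin k T hα⟩, rfl⟩
  rw [eq_top_iff]
  intro x _
  have hx : x ∈ (⊥ : IntermediateField E L) := by rw [← h2, h1]; trivial
  obtain ⟨y, rfl⟩ := mem_bot.mp hx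
  exact y.2

/-- A finite extension `L` of an infinite field `k` whose module of differentials has dimension
at most `d ≥ 1` is generated by `d` elements. -/
lemma exists_adjoin_range_eq_top_of_finrank_kaehlerDifferential_le {k L : Type*} [Field k]
    [Infinite k] [Field L] [Algebra k L] [FiniteDimensional k L] {σ : Type*} [Finite σ]
    [Nonempty σ] (h : Module.finrank L (Ω[L⁄k]) ≤ Nat.card σ) :
    ∃ a : σ → L, Algebra.adjoin k (Set.range a) = ⊤ := by
  classical
  -- an element separating embeddings, with nonzero differential if possible
  obtain ⟨α, hα, hα'⟩ : ∃ α : L, (∀ φ ψ : L →ₐ[k] AlgebraicClosure L, φ ≠ ψ → φ α ≠ ψ α) ∧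
      (Nontrivial (Ω[L⁄k]) → D k L α ≠ 0) := by
    -- Each requirement on α is that it avoid a proper k-subspace: an equalizer of two embeddings,
    -- or the kernel of D. As k is infinite, finitely many such subspaces do not cover L. If Ω
    -- vanishes, the extra subspace is ⊥ and imposes nothing of use.
    let ι := Option {p : (L →ₐ[k] AlgebraicClosure L) × (L →ₐ[k] AlgebraicClosure L) // p.1 ≠ p.2}
    let W : ι → Subspace k L := fun i ↦ i.elim
      (if Nontrivial (Ω[L⁄k]) then LinearMap.ker (D k L).toLinearMap else ⊥)
      fun p ↦ LinearMap.ker (p.1.1.toLinearMap - p.1.2.toLinearMap)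
    have hW : ⋃ i, (W i : Set L) ≠ Set.univ := by
      intro hW
      obtain ⟨i, hi⟩ := Subspace.exists_eq_top_of_iUnion_eq_univ hW
      cases i with
      | none =>
        simp only [W, Option.elim] at hi
        split_ifs at hi with hn
        · have : Submodule.span L (Set.range (D k L)) = ⊥ := by
            rw [Submodule.span_eq_bot]
            rintro _ ⟨x, rfl⟩
            have : x ∈ LinearMap.ker (D k L).toLinearMap := hi ▸ trivial
            exact this
          rw [span_range_derivation] at this
          exact top_ne_bot this
        · exact bot_ne_top hi
      | some p =>
        refine p.2 (AlgHom.ext fun x ↦ ?_)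
        have : x ∈ W (some p) := hi ▸ trivial
        simpa [W, sub_eq_zero] using this
    obtain ⟨α, hα⟩ := (Set.ne_univ_iff_exists_notMem _).mp hW
    simp only [Set.mem_iUnion, not_exists] at hα
    refine ⟨α, fun φ ψ hφψ hh ↦ hα (some ⟨(φ, ψ), hφψ⟩) ?_, fun hn hh ↦ hα none ?_⟩
    · simp [W, hh]
    · simpa [W, hn] using hh
  obtain ⟨T, hαT, hTspan, hTcard⟩ : ∃ T : Set L, α ∈ T ∧ Submodule.span L (D k L '' T) = ⊤ ∧
      ∃ f : T → σ, Function.Injective f := by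
    rcases subsingleton_or_nontrivial (Ω[L⁄k]) with hs | hn
    · exact ⟨{α}, rfl, Subsingleton.elim _ _, fun _ ↦ Classical.arbitrary σ,
        Function.injective_of_subsingleton _⟩
    -- The differentials of all elements span, so D α ≠ 0 extends to a basis made of differentials;
    -- hence α itself costs no extra generator.
    · obtain ⟨b, -, hb, hspan, hli⟩ := exists_linearIndepOn_extension (K := L) (v := D k L)
        (s := {α}) (t := Set.univ) (by
          rw [linearIndepOn_singleton_iff]; exact hα' hn) (Set.subset_univ _)
      refine ⟨b, hb rfl, ?_, ?_⟩
      · rw [eq_top_iff, ← span_range_derivation, Submodule.span_le, ← Set.image_univ]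
        exact hspan
      · have hfin : Finite b := hli.finite
        have := Fintype.ofFinite b
        have := Fintype.ofFinite σ
        have hc : Fintype.card b ≤ Fintype.card σ := by
          rw [← Nat.card_eq_fintype_card (α := σ)]
          exact (LinearIndependent.fintype_card_le_finrank hli).trans h
        obtain ⟨f⟩ := Function.Embedding.nonempty_of_card_le hc
        exact ⟨f, f.injective⟩
  have : Nonempty T := ⟨⟨α, hαT⟩⟩
  obtain ⟨f, hf⟩ := hTcard
  refine ⟨fun i ↦ (Function.invFun f i : T), ?_⟩
  have hr : Set.range (fun i ↦ ((Function.invFun f i : T) : L)) = T := by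
    change Set.range (Subtype.val ∘ Function.invFun f) = T
    rw [Set.range_comp, (Function.invFun_surjective hf).range_eq, Set.image_univ,
      Subtype.range_coe]
  rw [hr, ← IntermediateField.adjoin_toSubalgebra,
    IntermediateField.adjoin_eq_top_of_span_D_eq_top T hTspan α hαT, top_toSubalgebra]
  intro φ ψ hφ
  by_contra hne
  exact hα φ ψ hne hφ

/-- Translating a tuple of generators, one avoids a given hypersurface. -/
lemma exists_adjoin_range_eq_top_aeval_ne_zero {k L : Type*} [Field k] [Infinite k] [Field L]
    [Algebra k L] {σ : Type*} (a : σ → L) (ha : Algebra.adjoin k (Set.range a) = ⊤)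
    (f : MvPolynomial σ k) (hf : f ≠ 0) :
    ∃ b : σ → L, Algebra.adjoin k (Set.range b) = ⊤ ∧ MvPolynomial.aeval b f ≠ 0 := by
  by_contra! H
  have key (c : σ → k) : MvPolynomial.aeval (fun i ↦ a i + algebraMap k L (c i)) f = 0 := by
    apply H
    rw [eq_top_iff, ← ha, Algebra.adjoin_le_iff]
    rintro _ ⟨i, rfl⟩
    have h1 : a i + algebraMap k L (c i) ∈ Algebra.adjoin k
        (Set.range fun i ↦ a i + algebraMap k L (c i)) := Algebra.subset_adjoin ⟨i, rfl⟩
    simpa using sub_mem h1 (Subalgebra.algebraMap_mem _ (c i))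
  -- g is f(a + X) over L. It vanishes at every point with coordinates in the infinite field k, so
  -- it is zero, and substituting X - a recovers f = 0.
  let g : MvPolynomial σ L := MvPolynomial.aeval (fun i ↦ MvPolynomial.C (a i) + MvPolynomial.X i) f
  have hg : g = 0 := by
    refine MvPolynomial.funext_set (fun _ ↦ Set.range (algebraMap k L))
      (fun _ ↦ Set.infinite_range_of_injective (algebraMap k L).injective) fun x hx ↦ ?_
    choose c hc using fun i ↦ hx i trivial
    have : ((MvPolynomial.aeval x : MvPolynomial σ L →ₐ[L] L).restrictScalars k).comp
        (MvPolynomial.aeval (R := k) fun i ↦ MvPolynomial.C (a i) + MvPolynomial.X i) =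
        MvPolynomial.aeval (fun i ↦ a i + algebraMap k L (c i)) := by
      refine MvPolynomial.algHom_ext fun i ↦ ?_
      simp [hc]
    have := (DFunLike.congr_fun this f).trans (key c)
    rwa [map_zero, ← MvPolynomial.coe_aeval_eq_eval]
  apply hf
  apply MvPolynomial.map_injective _ (algebraMap k L).injective
  rw [map_zero]
  have : MvPolynomial.mapAlgHom (Algebra.ofId k L) = ((MvPolynomial.aeval
      (fun i ↦ MvPolynomial.X i - MvPolynomial.C (a i)) :
        MvPolynomial σ L →ₐ[L] MvPolynomial σ L).restrictScalars k).comp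
      (MvPolynomial.aeval (R := k) fun i ↦ MvPolynomial.C (a i) + MvPolynomial.X i) := by
    refine MvPolynomial.algHom_ext fun i ↦ ?_
    simp [MvPolynomial.algebraMap_eq]
  refine (DFunLike.congr_fun this f).trans ?_
  change MvPolynomial.aeval _ g = 0
  rw [hg, map_zero]

end FieldTheory

/-! ### Points of affine space with a given residue field -/

section Points

open KaehlerDifferential

/-- Over an infinite field `k`, a finite extension `L` whose differentials are spanned by `d`
elements is the residue field of a closed point of `𝔸^d` avoiding a given hypersurface. -/
lemma MvPolynomial.exists_algHom_surjective_apply_ne_zero {A k L σ : Type*} [CommRing A] [Field k]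
    [Infinite k] [Field L] [Algebra A k] [Algebra k L] [Algebra A L] [IsScalarTower A k L]
    [FiniteDimensional k L] (hk : Function.Surjective (algebraMap A k)) [Finite σ] [Nonempty σ]
    (v : σ → Ω[L⁄k]) (hv : Submodule.span L (Set.range v) = ⊤) (F : MvPolynomial σ A)
    (hF : F.map (algebraMap A k) ≠ 0) :
    ∃ e : MvPolynomial σ A →ₐ[A] L, Function.Surjective e ∧ e F ≠ 0 := by
  have := Fintype.ofFinite σ
  have hle : Module.finrank L (Ω[L⁄k]) ≤ Nat.card σ := by
    rw [← finrank_top, ← hv, Nat.card_eq_fintype_card]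
    exact finrank_range_le_card v
  obtain ⟨a, ha⟩ := exists_adjoin_range_eq_top_of_finrank_kaehlerDifferential_le hle
  obtain ⟨b, hb, hbF⟩ := exists_adjoin_range_eq_top_aeval_ne_zero a ha _ hF
  rw [MvPolynomial.aeval_map_algebraMap] at hbF
  refine ⟨MvPolynomial.aeval b, fun x ↦ ?_, hbF⟩
  have hx : x ∈ Algebra.adjoin k (Set.range b) := hb ▸ trivial
  rw [Algebra.adjoin_range_eq_range_aeval] at hx
  obtain ⟨p, rfl⟩ := hx
  obtain ⟨q, rfl⟩ := MvPolynomial.map_surjective _ hk p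
  exact ⟨q, by simp [MvPolynomial.aeval_map_algebraMap]⟩

/-- Being monic survives reduction modulo a maximal ideal. This is how the equations of finitely
many points of the fibres are multiplied into one hypersurface that does not contain a whole fibre.
-/
lemma MvPolynomial.map_aeval_X_ne_zero {A k σ : Type*} [CommRing A] [Field k] [Algebra A k]
    (i : σ) {p : Polynomial A} (hp : p.Monic) :
    MvPolynomial.map (algebraMap A k) (Polynomial.aeval (MvPolynomial.X i) p) ≠ 0 := by
  have h1 : MvPolynomial.map (algebraMap A k) (Polynomial.aeval (MvPolynomial.X i) p) =
      Polynomial.aeval (MvPolynomial.X i) (p.map (algebraMap A k)) := by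
    rw [Polynomial.aeval_def, Polynomial.hom_eval₂, Polynomial.aeval_def, Polynomial.eval₂_map,
      MvPolynomial.map_X]
    congr 1
    ext x; simp [MvPolynomial.algebraMap_eq]
  rw [h1]
  exact (transcendental_iff.mp (MvPolynomial.transcendental_X (R := k) i) _).mt
    (hp.map (algebraMap A k)).ne_zero

/-- The points of an open `U ⊆ 𝔸^σ_A` with residue field isomorphic to the `A`-algebra `L`. -/
def pointsWithResidueField {A : Type*} [CommRing A] {σ : Type*}
    (U : TopologicalSpace.Opens (PrimeSpectrum (MvPolynomial σ A))) (L : Type*) [CommRing L]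
    [Algebra A L] : Set (PrimeSpectrum (MvPolynomial σ A)) :=
  {x | x ∈ U ∧ ∃ e : MvPolynomial σ A →ₐ[A] L, Function.Surjective e ∧ RingHom.ker e = x.asIdeal}

lemma exists_monic_of_mem_pointsWithResidueField {A L σ : Type*} [CommRing A] [CommRing L]
    [Algebra A L] [Algebra.IsIntegral A L]
    {U : TopologicalSpace.Opens (PrimeSpectrum (MvPolynomial σ A))}
    {x : PrimeSpectrum (MvPolynomial σ A)} (hx : x ∈ pointsWithResidueField U L) (i : σ) :
    ∃ p : Polynomial A, p.Monic ∧ Polynomial.aeval (MvPolynomial.X i) p ∈ x.asIdeal := by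
  obtain ⟨-, e, -, he⟩ := hx
  obtain ⟨p, hp, hp'⟩ := Algebra.IsIntegral.isIntegral (R := A) (e (MvPolynomial.X i))
  refine ⟨p, hp, ?_⟩
  rw [← he, RingHom.mem_ker, ← Polynomial.aeval_algHom_apply]
  exact hp'

/-- Over an infinite field, `U` has a point with residue field `L` outside any finite set. -/
lemma exists_mem_pointsWithResidueField_notMem {A k L σ : Type*} [CommRing A] [Field k]
    [Infinite k] [Field L] [Algebra A k] [Algebra k L] [Algebra A L] [IsScalarTower A k L]
    [FiniteDimensional k L] (hk : Function.Surjective (algebraMap A k)) [Finite σ] [Nonempty σ]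
    (v : σ → Ω[L⁄k]) (hv : Submodule.span L (Set.range v) = ⊤)
    (U : TopologicalSpace.Opens (PrimeSpectrum (MvPolynomial σ A)))
    (hU : ∃ x ∈ U, RingHom.ker (algebraMap A k) ≤ x.asIdeal.comap (algebraMap A _))
    (S : Set (PrimeSpectrum (MvPolynomial σ A))) (hS : S.Finite)
    (hS' : ∀ x ∈ S, ∀ i, ∃ p : Polynomial A, p.Monic ∧
      Polynomial.aeval (MvPolynomial.X i) p ∈ x.asIdeal) :
    ∃ x ∈ pointsWithResidueField U L, x ∉ S := by
  classical
  obtain ⟨x, hxU, hx⟩ := hU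
  obtain ⟨_, ⟨_, ⟨F, rfl⟩, rfl⟩, hxF, hFU⟩ :=
    PrimeSpectrum.isBasis_basic_opens.exists_subset_of_mem_open hxU U.2
  have hF : F.map (algebraMap A k) ≠ 0 := by
    intro h
    apply hxF
    have h1 : F ∈ RingHom.ker (MvPolynomial.map (σ := σ) (algebraMap A k)) := h
    rw [MvPolynomial.ker_map] at h1
    exact Ideal.map_le_iff_le_comap.mpr hx h1
  choose p hp hpx using hS'
  let i : σ := Classical.arbitrary σ
  have := hS.fintype
  -- F cuts out a neighbourhood inside U and G vanishes on all of S; both are nonzero over k, so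
  -- avoiding F * G gives a point of U outside S.
  let G : MvPolynomial σ A := ∏ s : S, Polynomial.aeval (MvPolynomial.X i) (p s s.2 i)
  have hFG : (F * G).map (algebraMap A k) ≠ 0 := by
    rw [map_mul, map_prod]
    exact mul_ne_zero hF (Finset.prod_ne_zero_iff.mpr fun s _ ↦
      MvPolynomial.map_aeval_X_ne_zero i (hp s s.2 i))
  obtain ⟨e, he, heFG⟩ := MvPolynomial.exists_algHom_surjective_apply_ne_zero hk v hv _ hFG
  rw [map_mul] at heFG
  let y : PrimeSpectrum (MvPolynomial σ A) := ⟨RingHom.ker e, RingHom.ker_isPrime _⟩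
  refine ⟨y, ⟨hFU (show F ∉ RingHom.ker e from left_ne_zero_of_mul heFG), e, he, rfl⟩, fun hy ↦ ?_⟩
  apply right_ne_zero_of_mul heFG
  rw [map_prod]
  exact Finset.prod_eq_zero (Finset.mem_univ (⟨y, hy⟩ : S)) (hpx y hy i)

/-- For a finite field `L`, the points of `U` with residue field `L` are characterized by the
cardinality of the residue field. -/
lemma mem_pointsWithResidueField_of_natCard_eq {A k L σ : Type*} [CommRing A] [Field k]
    [Field L] [Algebra A k] [Algebra k L] [Algebra A L] [IsScalarTower A k L] [Finite L]
    (hk : Function.Surjective (algebraMap A k))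
    (U : TopologicalSpace.Opens (PrimeSpectrum (MvPolynomial σ A)))
    (x : PrimeSpectrum (MvPolynomial σ A)) (hxU : x ∈ U)
    (hx : RingHom.ker (algebraMap A k) ≤ x.asIdeal.comap (algebraMap A _))
    (hc : Nat.card (MvPolynomial σ A ⧸ x.asIdeal) = Nat.card L) :
    x ∈ pointsWithResidueField U L := by
  have : Finite (MvPolynomial σ A ⧸ x.asIdeal) :=
    Nat.finite_of_card_ne_zero (hc ▸ Nat.card_pos.ne')
  let : Field (MvPolynomial σ A ⧸ x.asIdeal) := (Finite.isField_of_domain _).toField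
  let φ : k →+* MvPolynomial σ A ⧸ x.asIdeal :=
    (Ideal.Quotient.lift _ (algebraMap A (MvPolynomial σ A ⧸ x.asIdeal)) fun a ha ↦ by
      rw [IsScalarTower.algebraMap_apply A (MvPolynomial σ A)]
      exact Ideal.Quotient.eq_zero_iff_mem.mpr (hx ha)).comp
      (RingHom.quotientKerEquivOfSurjective hk).symm.toRingHom
  algebraize [φ]
  have : IsScalarTower A k (MvPolynomial σ A ⧸ x.asIdeal) := .of_algebraMap_eq fun a ↦ by
    have : (RingHom.quotientKerEquivOfSurjective hk).symm (algebraMap A k a) =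
        Ideal.Quotient.mk _ a := by
      rw [RingEquiv.symm_apply_eq]; rfl
    simp [RingHom.algebraMap_toAlgebra, φ, this]
  have : Finite k := Finite.of_injective _ (algebraMap k L).injective
  have hfr : Module.finrank k (MvPolynomial σ A ⧸ x.asIdeal) = Module.finrank k L := by
    rw [Module.natCard_eq_pow_finrank (K := k),
      Module.natCard_eq_pow_finrank (K := k) (V := L)] at hc
    exact Nat.pow_right_injective Finite.one_lt_card hc
  -- Equal cardinality means equal degree over k, and finite fields of equal degree over k are
  -- isomorphic over k.
  obtain ⟨f⟩ := FiniteField.nonempty_algHom_of_finrank_dvd hfr.dvd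
  have hf : Function.Bijective f := by
    have := Module.finite_of_finite k (M := L)
    have := Module.finite_of_finite k (M := MvPolynomial σ A ⧸ x.asIdeal)
    exact ⟨f.toRingHom.injective,
      (LinearMap.injective_iff_surjective_of_finrank_eq_finrank (f := f.toLinearMap) hfr).mp
        f.toRingHom.injective⟩
  refine ⟨hxU, (f.restrictScalars A).comp (Ideal.Quotient.mkₐ A x.asIdeal),
    hf.2.comp Ideal.Quotient.mk_surjective, ?_⟩
  ext p
  simp only [RingHom.mem_ker, AlgHom.comp_apply, Ideal.Quotient.mkₐ_eq_mk]
  refine (map_eq_zero_iff f hf.1).trans ?_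
  exact Ideal.Quotient.eq_zero_iff_mem

end Points

/-! ### Greedy choice of distinct representatives -/

section Extend

/-- A partial system of distinct representatives that can always be extended by one element
extends to a full one. -/
lemma exists_injective_extension {T α : Type*} [Finite T] (S : T → Set α) (T₀ : Set T) (u₀ : T → α)
    (hinj : Set.InjOn u₀ T₀) (hmem : ∀ t ∈ T₀, u₀ t ∈ S t)
    (h : ∀ (T₁ : Set T) (u : T → α) (t : T), t ∉ T₁ → t ∉ T₀ → Set.InjOn u T₁ →
      (∀ s ∈ T₁, u s ∈ S s) → ∃ x ∈ S t, x ∉ u '' T₁) :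
    ∃ u : T → α, Function.Injective u ∧ (∀ t, u t ∈ S t) ∧ ∀ t ∈ T₀, u t = u₀ t := by
  classical
  suffices H : ∀ R : Set T, R.Finite → ∃ u : T → α, Set.InjOn u (T₀ ∪ R) ∧
      (∀ t ∈ T₀ ∪ R, u t ∈ S t) ∧ ∀ t ∈ T₀, u t = u₀ t by
    obtain ⟨u, h1, h2, h3⟩ := H Set.univ Set.finite_univ
    rw [Set.union_univ] at h1 h2
    exact ⟨u, Set.injOn_univ.mp h1, fun t ↦ h2 t trivial, h3⟩
  intro R hR
  induction R, hR using Set.Finite.induction_on with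
  | empty => exact ⟨u₀, by simpa using hinj, by simpa using hmem, fun _ _ ↦ rfl⟩
  | @insert t R htR hR ih =>
    obtain ⟨u, h1, h2, h3⟩ := ih
    rw [Set.union_insert]
    by_cases ht : t ∈ T₀ ∪ R
    · rw [Set.insert_eq_of_mem ht]
      exact ⟨u, h1, h2, h3⟩
    obtain ⟨x, hx, hx'⟩ := h _ u t ht (fun h ↦ ht (Or.inl h)) h1 h2
    have hne : ∀ s ∈ T₀ ∪ R, Function.update u t x s = u s := fun s hs ↦
      Function.update_of_ne (by rintro rfl; exact ht hs) _ _
    refine ⟨Function.update u t x, ?_, ?_, fun s hs ↦ (hne s (Or.inl hs)).trans (h3 s hs)⟩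
    · rw [Set.injOn_insert ht]
      refine ⟨fun a ha b hb hab ↦ h1 ha hb (by rwa [hne a ha, hne b hb] at hab), ?_⟩
      rw [Set.image_congr hne]
      simpa using hx'
    · rintro s (rfl | hs)
      · simpa using hx
      · rw [hne s hs]; exact h2 s hs

end Extend

/-! ### Adjusting tuples of functions so that their differentials span -/

section Adjust

/-- Vectors `w i`, at least `dim V` in number, that span `V` modulo a subspace `U` can be
modified by elements of `U` so as to span `V`. -/
lemma exists_span_range_add_eq_top {K V σ : Type*} [Field K] [AddCommGroup V] [Module K V]
    [FiniteDimensional K V] [Finite σ] (h : Module.finrank K V ≤ Nat.card σ) (w : σ → V)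
    (U : Submodule K V) (hw : Submodule.span K (Set.range w) ⊔ U = ⊤) :
    ∃ u : σ → V, (∀ i, u i ∈ U) ∧ Submodule.span K (Set.range (w + u)) = ⊤ := by
  classical
  have := Fintype.ofFinite σ
  obtain ⟨_, ⟨u, hu, rfl⟩, hmax⟩ := (wellFounded_gt (α := Submodule K V)).has_min
    {N | ∃ u : σ → V, (∀ i, u i ∈ U) ∧ Submodule.span K (Set.range (w + u)) = N}
    ⟨_, 0, fun _ ↦ zero_mem _, rfl⟩
  refine ⟨u, hu, ?_⟩
  by_contra hne
  -- At a maximal but proper span, at least dim V vectors are dependent, so one lies in the span of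
  -- the others. Moving it by a vector of U outside the span loses nothing and enlarges the span.
  have hli : ¬ LinearIndependent K (w + u) := fun hli ↦ hne <|
    hli.span_eq_top_of_card_eq_finrank' <|
      le_antisymm hli.fintype_card_le_finrank (by rwa [← Nat.card_eq_fintype_card])
  rw [linearIndependent_iff_notMem_span] at hli
  push Not at hli
  obtain ⟨i, hi⟩ := hli
  obtain ⟨v, hvU, hv⟩ : ∃ v ∈ U, v ∉ Submodule.span K (Set.range (w + u)) := by
    by_contra! H
    refine hne (eq_top_iff.mpr (hw ▸ sup_le ?_ H))
    rw [Submodule.span_le]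
    rintro _ ⟨j, rfl⟩
    have := sub_mem (Submodule.subset_span (R := K) (Set.mem_range_self (f := w + u) j)) (H _ (hu j))
    simpa using this
  have hle : Submodule.span K ((w + u) '' (Set.univ \ {i})) ≤
      Submodule.span K (Set.range (w + Function.update u i (u i + v))) := by
    refine Submodule.span_mono ?_
    rintro _ ⟨j, hj, rfl⟩
    refine ⟨j, ?_⟩
    have : j ≠ i := by simpa using hj
    simp [Function.update_of_ne this]
  have hvmem : v ∈ Submodule.span K (Set.range (w + Function.update u i (u i + v))) := by
    have := sub_mem (Submodule.subset_span (R := K)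
      (Set.mem_range_self (f := w + Function.update u i (u i + v)) i)) (hle hi)
    simpa [add_assoc, add_sub_add_left_eq_sub] using this
  refine hmax _ ⟨Function.update u i (u i + v), fun j ↦ ?_, rfl⟩ (lt_of_le_of_ne ?_ ?_)
  · by_cases hj : j = i
    · subst hj; simpa using add_mem (hu j) hvU
    · simpa [Function.update_of_ne hj] using hu j
  · rw [Submodule.span_le]
    rintro _ ⟨j, rfl⟩
    by_cases hj : j = i
    · subst hj; exact hle hi
    · exact hle (Submodule.subset_span ⟨j, by simpa using hj, rfl⟩)
  · intro heq
    exact hv (heq ▸ hvmem)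

lemma Submodule.span_range_mkQ_eq_top_iff {R M σ : Type*} [CommRing R] (n : Ideal R)
    [AddCommGroup M] [Module R M] (w : σ → M) :
    span (R ⧸ n) (Set.range fun i ↦ (n • (⊤ : Submodule R M)).mkQ (w i)) = ⊤ ↔
      span R (Set.range w) ⊔ n • ⊤ = ⊤ := by
  rw [← restrictScalars_eq_top_iff R,
    restrictScalars_span R (R ⧸ n) Ideal.Quotient.mk_surjective, sup_comm, ← map_mkQ_eq_top,
    map_span, ← Set.range_comp]
  rfl

/-- This is linear algebra in M/nM over the residue field. The family ω serves only to bound the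
dimension of M/nM by the size of σ. -/
lemma exists_span_range_add_sup_smul_eq_top {R M σ : Type*} [CommRing R] (n : Ideal R)
    [n.IsMaximal] [AddCommGroup M] [Module R M] [Finite σ] (ω : σ → M)
    (hω : Submodule.span R (Set.range ω) ⊔ n • ⊤ = ⊤) (w : σ → M) (U : Submodule R M)
    (hw : Submodule.span R (Set.range w) ⊔ U ⊔ n • ⊤ = ⊤) :
    ∃ u : σ → M, (∀ i, u i ∈ U) ∧ Submodule.span R (Set.range (w + u)) ⊔ n • ⊤ = ⊤ := by
  classical
  let := Ideal.Quotient.field n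
  have := Fintype.ofFinite σ
  set Q := (n • (⊤ : Submodule R M)).mkQ
  rw [← Submodule.span_range_mkQ_eq_top_iff] at hω
  have : Module.Finite (R ⧸ n) (M ⧸ (n • (⊤ : Submodule R M))) :=
    ⟨⟨Finset.univ.image fun i ↦ Q (ω i), by
      rw [Finset.coe_image, Finset.coe_univ, Set.image_univ]; exact hω⟩⟩
  have hle : Module.finrank (R ⧸ n) (M ⧸ (n • (⊤ : Submodule R M))) ≤ Nat.card σ := by
    rw [← finrank_top, ← hω, Nat.card_eq_fintype_card]
    exact finrank_range_le_card _
  obtain ⟨u, hu, hspan⟩ := exists_span_range_add_eq_top hle (fun i ↦ Q (w i))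
    (Submodule.span (R ⧸ n) (Q '' U)) (by
      rw [← Submodule.span_union, ← Submodule.restrictScalars_eq_top_iff R,
        Submodule.restrictScalars_span R (R ⧸ n) Ideal.Quotient.mk_surjective,
        show (Set.range fun i ↦ Q (w i)) = Q '' Set.range w from Set.range_comp Q w,
        ← Set.image_union, ← Submodule.map_span, Submodule.map_mkQ_eq_top,
        Submodule.span_union, Submodule.span_eq, sup_comm, hw])
  have hu' (i) : ∃ v ∈ U, Q v = u i := by
    have := hu i
    rw [← Submodule.restrictScalars_mem R,
      Submodule.restrictScalars_span R (R ⧸ n) Ideal.Quotient.mk_surjective, ← Submodule.map_span,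
      Submodule.span_eq] at this
    exact this
  choose v hv hvu using hu'
  refine ⟨v, hv, ?_⟩
  rw [← Submodule.span_range_mkQ_eq_top_iff, ← hspan]
  congr 2
  ext i
  simp [Q, ← hvu]

lemma Submodule.span_range_sup_congr {R M σ : Type*} [CommRing R] [AddCommGroup M] [Module R M]
    {w w' : σ → M} {N : Submodule R M} (h : ∀ i, w i - w' i ∈ N) :
    span R (Set.range w) ⊔ N = span R (Set.range w') ⊔ N := by
  have key : ∀ {w w' : σ → M}, (∀ i, w i - w' i ∈ N) →
      span R (Set.range w) ⊔ N ≤ span R (Set.range w') ⊔ N := by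
    intro w w' h
    refine sup_le (span_le.mpr ?_) le_sup_right
    rintro _ ⟨i, rfl⟩
    have := add_mem (mem_sup_left (T := N) (subset_span (R := R) (Set.mem_range_self (f := w') i)))
      (mem_sup_right (S := span R (Set.range w')) (h i))
    simpa using this
  refine le_antisymm (key h) (key fun i ↦ ?_)
  rw [← neg_sub]
  exact neg_mem (h i)

variable {A R M σ : Type*} [CommRing A] [CommRing R] [Algebra A R] [AddCommGroup M] [Module R M]
  [Module A M] (D : Derivation A R M)

include D in
-- By Leibniz r • D δ and D (r δ) differ by δ • D r, which lies in n • M because δ ∈ I ≤ n. So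
-- modulo n the differentials of I already form a submodule.
lemma Derivation.exists_mem_sub_mem_smul_of_mem_span {I n : Ideal R} (hI : I ≤ n) {u : M}
    (hu : u ∈ Submodule.span R (D '' I)) : ∃ δ ∈ I, u - D δ ∈ n • (⊤ : Submodule R M) := by
  induction hu using Submodule.span_induction with
  | mem x hx => obtain ⟨δ, hδ, rfl⟩ := hx; exact ⟨δ, hδ, by simp⟩
  | zero => exact ⟨0, zero_mem _, by simp⟩
  | add x y _ _ hx hy =>
    obtain ⟨δ, hδ, h⟩ := hx
    obtain ⟨ε, hε, h'⟩ := hy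
    refine ⟨δ + ε, add_mem hδ hε, ?_⟩
    rw [map_add, add_sub_add_comm]
    exact add_mem h h'
  | smul r x _ hx =>
    obtain ⟨δ, hδ, h⟩ := hx
    refine ⟨r * δ, I.mul_mem_left r hδ, ?_⟩
    rw [Derivation.leibniz, ← sub_sub, ← smul_sub]
    exact sub_mem (Submodule.smul_mem _ r h) (Submodule.smul_mem_smul (hI hδ) trivial)

include D in
lemma Derivation.map_mul_sub_smul_mem {I n : Ideal R} (hI : I ≤ n) {δ : R} (hδ : δ ∈ I)
    (e c : R) (h : e - c ∈ n) : D (e * δ) - c • D δ ∈ n • (⊤ : Submodule R M) := by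
  rw [Derivation.leibniz, add_sub_right_comm, ← sub_smul]
  exact add_mem (Submodule.smul_mem_smul h trivial) (Submodule.smul_mem_smul (hI hδ) trivial)

/-- Given functions `c i` whose differentials span `Ω` at finitely many closed points up to
differentials of elements of an ideal `I`, one can modify `c` by elements of `I` so that the
differentials span at these points. -/
lemma Derivation.exists_span_range_D_add_eq_top [Finite σ] {T : Type*} [Finite T]
    (n : T → Ideal R) [∀ t, (n t).IsMaximal] (hn : Function.Injective n) (I : Ideal R)
    (hI : ∀ t, I ≤ n t) (c : σ → R)
    (hω : ∀ t, ∃ ω : σ → M, Submodule.span R (Set.range ω) ⊔ n t • ⊤ = ⊤)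
    (hc : ∀ t, Submodule.span R (Set.range fun i ↦ D (c i)) ⊔ Submodule.span R (D '' I) ⊔
      n t • ⊤ = ⊤) :
    ∃ δ : σ → R, (∀ i, δ i ∈ I) ∧
      ∀ t, Submodule.span R (Set.range fun i ↦ D (c i + δ i)) ⊔ n t • ⊤ = ⊤ := by
  classical
  have := Fintype.ofFinite T
  choose ω hω using hω
  choose u hu hu' using fun t ↦ exists_span_range_add_sup_smul_eq_top (n t) (ω t) (hω t) _ _ (hc t)
  choose δ hδ hδ' using fun t i ↦ D.exists_mem_sub_mem_smul_of_mem_span (hI t) (hu t i)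
  have hcop : Pairwise (Function.onFun IsCoprime n) := fun s t hst ↦ by
    refine Ideal.isCoprime_iff_sup_eq.mpr (Ideal.IsMaximal.coprime_of_ne inferInstance inferInstance ?_)
    exact hn.ne hst
  -- The e t are 1 at the point t and 0 at the others, so the corrections found at each point can be
  -- glued without interference.
  choose e he using fun t : T ↦ Ideal.exists_forall_sub_mem_ideal hcop
    (fun s ↦ if t = s then (1 : R) else 0)
  refine ⟨fun i ↦ ∑ t, e t * δ t i, fun i ↦ sum_mem fun t _ ↦ I.mul_mem_left _ (hδ t i),
    fun t ↦ ?_⟩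
  refine Eq.trans ?_ (hu' t)
  refine Submodule.span_range_sup_congr fun i ↦ ?_
  have hsum : D (∑ s, e s * δ s i) - D (δ t i) ∈ n t • (⊤ : Submodule R M) := by
    have := sum_mem (t := Finset.univ) fun s (_ : s ∈ Finset.univ) ↦
      D.map_mul_sub_smul_mem (hI t) (hδ s i) (e s) _ (he s t)
    rw [Finset.sum_sub_distrib, ← map_sum] at this
    simpa using this
  rw [map_add, Pi.add_apply, add_sub_add_left_eq_sub, ← sub_sub_sub_cancel_right _ _ (D (δ t i))]
  exact sub_mem hsum (hδ' t i)

lemma Derivation.map_aeval_mem_span (c : σ → R) (p : MvPolynomial σ A) :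
    D (MvPolynomial.aeval c p) ∈ Submodule.span R (Set.range fun i ↦ D (c i)) := by
  induction p using MvPolynomial.induction_on with
  | C a => simp
  | add p q hp hq => rw [map_add, map_add]; exact add_mem hp hq
  | mul_X p i hp =>
    rw [map_mul, Derivation.leibniz, MvPolynomial.aeval_X]
    exact add_mem (Submodule.smul_mem _ _ (Submodule.subset_span ⟨i, rfl⟩))
      (Submodule.smul_mem _ _ hp)

/-- If, near the closed point `n`, every function is a polynomial in the `c i` modulo `I`, then
`Ω` is spanned at `n` by the differentials of the `c i` and of elements of `I`. -/
lemma Derivation.span_range_D_sup_span_image_eq_top (hD : Submodule.span R (Set.range D) = ⊤)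
    (n I : Ideal R) [n.IsMaximal] (hI : I ≤ n) (c : σ → R)
    (h : ∀ r : R, ∃ p : MvPolynomial σ A, ∃ s ∉ n, s * (r - MvPolynomial.aeval c p) ∈ I) :
    Submodule.span R (Set.range fun i ↦ D (c i)) ⊔ Submodule.span R (D '' I) ⊔ n • ⊤ = ⊤ := by
  set N := Submodule.span R (Set.range fun i ↦ D (c i)) ⊔ Submodule.span R (D '' I) ⊔ n • ⊤
  rw [eq_top_iff, ← hD, Submodule.span_le]
  rintro _ ⟨r, rfl⟩
  obtain ⟨p, s, hs, hsε⟩ := h r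
  set ε := r - MvPolynomial.aeval c p
  have hr : D r = D (MvPolynomial.aeval c p) + D ε := by rw [← map_add]; simp [ε]
  rw [hr]
  have hn : n • (⊤ : Submodule R M) ≤ N := le_sup_right
  refine add_mem ((le_sup_left.trans le_sup_left : _ ≤ N) (D.map_aeval_mem_span c p)) ?_
  have hε : ε ∈ n := (‹n.IsMaximal›.isPrime.mem_or_mem (hI hsε)).resolve_left hs
  -- D (s ε) = s • D ε + ε • D s, and the last term is zero modulo n. Since s is invertible modulo
  -- n, D ε itself follows.
  have h1 : s • D ε ∈ N := by
    have h2 : D (s * ε) ∈ N :=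
      (le_sup_right.trans le_sup_left : _ ≤ N) (Submodule.subset_span ⟨_, hsε, rfl⟩)
    rw [Derivation.leibniz] at h2
    exact (Submodule.add_mem_iff_left _ (hn (Submodule.smul_mem_smul hε trivial))).mp h2
  obtain ⟨t, m, hm, hst⟩ := ‹n.IsMaximal›.exists_inv hs
  rw [← one_smul R (D ε), ← hst, add_smul, mul_smul]
  exact add_mem (Submodule.smul_mem _ _ h1) (hn (Submodule.smul_mem_smul hm trivial))

end Adjust

/-! ### Étaleness over affine space in terms of differentials -/

section Etale

open KaehlerDifferential TensorProduct

/-- The Jacobian criterion: a formally smooth algebra with free differentials is formally étale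
over a polynomial ring in as many variables if the differentials of the variables span. -/
lemma MvPolynomial.formallyEtale_of_span_range_D_eq_top {A S σ : Type*} [CommRing A] [CommRing S]
    [Finite σ] [Algebra A S] [Algebra (MvPolynomial σ A) S] [IsScalarTower A (MvPolynomial σ A) S]
    [Algebra.FormallySmooth A S] (b : Module.Basis σ S (Ω[S⁄A]))
    (h : Submodule.span S (Set.range fun i : σ ↦
      D A S (algebraMap (MvPolynomial σ A) S (MvPolynomial.X i))) = ⊤) :
    Algebra.FormallyEtale (MvPolynomial σ A) S := by
  set P := MvPolynomial σ A
  have hsurj : Function.Surjective (mapBaseChange A P S) := by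
    rw [← LinearMap.range_eq_top, eq_top_iff, ← h, Submodule.span_le]
    rintro _ ⟨i, rfl⟩
    exact ⟨1 ⊗ₜ D A P (MvPolynomial.X i), by simp [P]⟩
  let e : S ⊗[P] Ω[P⁄A] ≃ₗ[S] Ω[S⁄A] :=
    ((mvPolynomialBasis A σ).baseChange S).equiv b (Equiv.refl σ)
  have : Module.Finite S (Ω[S⁄A]) := .of_basis b
  -- Source and target are free on σ, and a surjective endomorphism of a finite module is injective.
  -- The cotangent sequence then kills both Ω[S/P] and H1 of S over P, the latter because H1 of S
  -- over A vanishes by smoothness.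
  have hinj : Function.Injective (mapBaseChange A P S) := by
    have h1 : Function.Surjective (mapBaseChange A P S ∘ₗ e.symm.toLinearMap) :=
      hsurj.comp e.symm.surjective
    have h2 := OrzechProperty.injective_of_surjective_endomorphism _ h1
    intro x y hxy
    rw [← e.symm_apply_apply x, ← e.symm_apply_apply y]
    congr 1
    exact h2 (by simpa using hxy)
  rw [Algebra.formallyEtale_iff]
  constructor
  · have h1 : ∀ y : Ω[S⁄A], KaehlerDifferential.map A P S S y = 0 := fun y ↦
      (exact_mapBaseChange_map A P S y).mpr (hsurj y)
    refine ⟨fun x y ↦ ?_⟩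
    obtain ⟨x, rfl⟩ := KaehlerDifferential.map_surjective A P S x
    obtain ⟨y, rfl⟩ := KaehlerDifferential.map_surjective A P S y
    rw [h1, h1]
  · suffices H : ∀ x : Algebra.H1Cotangent P S, x = 0 from ⟨fun x y ↦ by rw [H x, H y]⟩
    intro x
    have h1 : Algebra.H1Cotangent.δ A P S x = 0 := hinj <| by
      rw [map_zero]
      exact (Algebra.H1Cotangent.exact_δ_mapBaseChange A P S _).mpr ⟨x, rfl⟩
    obtain ⟨y, rfl⟩ := (Algebra.H1Cotangent.exact_map_δ A P S x).mp h1
    rw [Subsingleton.elim y 0, map_zero]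

variable {A R σ : Type*} [CommRing A] [CommRing R] [Algebra A R]

/-- Nakayama over the local ring at n: spanning modulo n already implies spanning of the localized
differentials. -/
lemma KaehlerDifferential.span_range_D_localization_eq_top (n : Ideal R) [n.IsPrime] (a : σ → R)
    [Module.Finite (Localization.AtPrime n) (Ω[Localization.AtPrime n⁄A])]
    (h : Submodule.span R (Set.range fun i ↦ D A R (a i)) ⊔ n • ⊤ = ⊤) :
    Submodule.span (Localization.AtPrime n) (Set.range fun i ↦
      D A (Localization.AtPrime n) (algebraMap R _ (a i))) = ⊤ := by
  set S := Localization.AtPrime n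
  set N := Submodule.span S (Set.range fun i ↦ D A S (algebraMap R _ (a i)))
  rw [eq_top_iff]
  refine Submodule.le_of_le_smul_of_le_jacobson_bot (I := IsLocalRing.maximalIdeal S)
    Module.Finite.fg_top (IsLocalRing.maximalIdeal_le_jacobson _) ?_
  rw [← KaehlerDifferential.span_range_map_derivation_of_isLocalization A R S n.primeCompl]
  refine Submodule.span_le.mpr ?_
  rintro _ ⟨r, rfl⟩
  rw [KaehlerDifferential.span_range_map_derivation_of_isLocalization A R S n.primeCompl]
  set Q : Submodule S (Ω[S⁄A]) := N ⊔ IsLocalRing.maximalIdeal S • ⊤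
  suffices H : (⊤ : Submodule R (Ω[R⁄A])) ≤ (Q.restrictScalars R).comap (map A A R S) from
    H (Submodule.mem_top (x := D A R r))
  rw [← h]
  refine sup_le ?_ ?_
  · rw [Submodule.span_le]
    rintro _ ⟨i, rfl⟩
    refine (le_sup_left : N ≤ Q) (Submodule.subset_span ⟨i, ?_⟩)
    simp
  · rw [Submodule.smul_le]
    intro s hs x _
    refine (le_sup_right : _ ≤ Q) ?_
    rw [map_smul, ← algebraMap_smul S s]
    refine Submodule.smul_mem_smul ?_ trivial
    exact (IsLocalization.AtPrime.to_map_mem_maximal_iff S n s).mpr hs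

lemma KaehlerDifferential.exists_span_range_sup_smul_eq_top (n : Ideal R) [n.IsMaximal]
    (b : Module.Basis σ (Localization.AtPrime n) (Ω[Localization.AtPrime n⁄A])) :
    ∃ ω : σ → Ω[R⁄A], Submodule.span R (Set.range ω) ⊔ n • ⊤ = ⊤ := by
  set S := Localization.AtPrime n
  let f := map A A R S
  choose p hp using fun i ↦ IsLocalizedModule.surj n.primeCompl f (b i)
  refine ⟨fun i ↦ (p i).1, ?_⟩
  set N := Submodule.span R (Set.range fun i ↦ (p i).1)
  have htop : N.localized' S n.primeCompl f = ⊤ := by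
    rw [Submodule.localized'_span, eq_top_iff, ← b.span_eq, Submodule.span_le]
    rintro _ ⟨i, rfl⟩
    have h1 : (p i).2 • b i ∈ Submodule.span S (f '' Set.range fun i ↦ (p i).1) := by
      rw [hp]; exact Submodule.subset_span ⟨_, ⟨i, rfl⟩, rfl⟩
    have hu : IsUnit (algebraMap R S (p i).2) := IsLocalization.map_units S (p i).2
    rw [Submonoid.smul_def, ← algebraMap_smul S] at h1
    exact (Submodule.smul_mem_iff_of_isUnit _ hu).mp h1
  rw [eq_top_iff]
  intro x _
  have hx : f x ∈ N.localized' S n.primeCompl f := htop ▸ trivial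
  obtain ⟨m, hm, s, hms⟩ := (Submodule.mem_localized' ..).mp hx
  rw [IsLocalizedModule.mk'_eq_iff] at hms
  rw [Submonoid.smul_def, ← map_smul] at hms
  obtain ⟨t, ht⟩ := (IsLocalizedModule.eq_iff_exists n.primeCompl f).mp hms
  have hts : (t * s : R) ∉ n := n.primeCompl.mul_mem t.2 s.2
  obtain ⟨c, e, he, hc⟩ := ‹n.IsMaximal›.exists_inv hts
  rw [← one_smul R x, ← hc, add_smul, mul_smul]
  refine add_mem (Submodule.mem_sup_left (Submodule.smul_mem _ _ ?_))
    (Submodule.mem_sup_right (Submodule.smul_mem_smul he trivial))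
  rw [mul_smul]
  change (t : R) • ((s : R) • x) ∈ N
  have h2 : (t : R) • m = (t : R) • (s : R) • x := ht
  rw [← h2]
  exact Submodule.smul_mem _ _ hm

/-- An algebra with smooth structure is étale over affine space at points where the differentials
of the coordinates span the differentials. -/
lemma MvPolynomial.isEtaleAt_of_span_range_D_sup_smul_eq_top [Finite σ] [Algebra (MvPolynomial σ A) R]
    [IsScalarTower A (MvPolynomial σ A) R] [Algebra.FormallySmooth A R] (n : Ideal R)
    [n.IsPrime] (b : Module.Basis σ (Localization.AtPrime n) (Ω[Localization.AtPrime n⁄A]))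
    (h : Submodule.span R (Set.range fun i : σ ↦
      D A R (algebraMap (MvPolynomial σ A) R (MvPolynomial.X i))) ⊔ n • ⊤ = ⊤) :
    Algebra.IsEtaleAt (MvPolynomial σ A) n := by
  have : Algebra.FormallySmooth R (Localization.AtPrime n) := .of_isLocalization n.primeCompl
  have : Algebra.FormallySmooth A (Localization.AtPrime n) := .comp A R _
  have : Module.Finite (Localization.AtPrime n) (Ω[Localization.AtPrime n⁄A]) := .of_basis b
  refine MvPolynomial.formallyEtale_of_span_range_D_eq_top b ?_
  exact KaehlerDifferential.span_range_D_localization_eq_top n _ h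

end Etale

/-! ### A criterion for closed immersions -/

section Surjective

open KaehlerDifferential

/-- Nakayama in global form: if M/N ≠ 0, its annihilator lies in some maximal q, whereas M/N =
q(M/N) yields an annihilator congruent to 1 modulo q. -/
lemma Submodule.eq_top_of_forall_sup_smul_eq_top {B M : Type*} [CommRing B] [AddCommGroup M]
    [Module B M] [Module.Finite B M] (N : Submodule B M)
    (h : ∀ q : Ideal B, q.IsMaximal → N ⊔ q • ⊤ = ⊤) : N = ⊤ := by
  by_contra hne
  have hann : Module.annihilator B (M ⧸ N) ≠ ⊤ := by
    rw [Ne, Module.annihilator_eq_top_iff, Submodule.Quotient.subsingleton_iff]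
    exact hne
  obtain ⟨q, hq, hle⟩ := Ideal.exists_le_maximal _ hann
  have h1 : (⊤ : Submodule B (M ⧸ N)) ≤ q • ⊤ := by
    have := congr_arg (Submodule.map N.mkQ) (h q hq)
    rw [Submodule.map_sup, Submodule.mkQ_map_self, bot_sup_eq, Submodule.map_smul'',
      Submodule.map_top, Submodule.range_mkQ] at this
    exact this.ge
  obtain ⟨r, hr, hr'⟩ :=
    Submodule.exists_sub_one_mem_and_smul_eq_zero_of_fg_of_le_smul q _ Module.Finite.fg_top h1
  have hrq : r ∈ q := hle (Module.mem_annihilator.mpr fun m ↦ hr' m trivial)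
  exact hq.ne_top ((Ideal.eq_top_iff_one q).mpr (by simpa using sub_mem hrq hr))

variable {P R : Type*} [CommRing P] [CommRing R] [Algebra P R] (I : Ideal R)

lemma Algebra.FormallyUnramified.of_surjective_of_forall_isMaximal {B : Type*} [CommRing B]
    [Algebra R B] [Algebra P B] [IsScalarTower P R B] [Algebra.FiniteType P B]
    (hB : Function.Surjective (algebraMap R B))
    (hΩ : ∀ q : Ideal B, q.IsMaximal →
      (⊤ : Submodule R (Ω[R⁄P])) ≤ q.comap (algebraMap R B) • ⊤) :
    Algebra.FormallyUnramified P B := by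
  suffices H : (⊥ : Submodule B (Ω[B⁄P])) = ⊤ from
    ⟨(Submodule.subsingleton_iff B).mp (subsingleton_iff_bot_eq_top.mp H)⟩
  refine Submodule.eq_top_of_forall_sup_smul_eq_top _ fun q hq ↦ ?_
  rw [bot_sup_eq]
  refine top_le_iff.mp ((span_range_derivation P B).ge.trans (Submodule.span_le.mpr ?_))
  rintro _ ⟨x, rfl⟩
  obtain ⟨r, rfl⟩ := hB x
  have H : q.comap (algebraMap R B) • (⊤ : Submodule R (Ω[R⁄P])) ≤
      ((q • (⊤ : Submodule B (Ω[B⁄P]))).restrictScalars R).comap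
        (KaehlerDifferential.map P P R B) := by
    rw [Submodule.smul_le]
    intro s hs y _
    rw [Submodule.mem_comap, map_smul, ← algebraMap_smul B s, Submodule.restrictScalars_mem]
    exact Submodule.smul_mem_smul (Ideal.mem_comap.mp hs) Submodule.mem_top
  have := Submodule.mem_comap.mp (H (hΩ q hq (Submodule.mem_top (x := D P R r))))
  rwa [Submodule.restrictScalars_mem, KaehlerDifferential.map_D] at this

/-- A finite `P`-algebra `R ⧸ I` that is unramified with trivial residue field extensions and
injective on closed points is a quotient of `P`. -/
lemma Ideal.Quotient.algebraMap_surjective_of_forall_isMaximal [Module.Finite P (R ⧸ I)]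
    (hΩ : ∀ n : Ideal R, n.IsMaximal → I ≤ n → (⊤ : Submodule R (Ω[R⁄P])) ≤ n • ⊤)
    (hres : ∀ n : Ideal R, n.IsMaximal → I ≤ n → ∀ r : R, ∃ p : P, r - algebraMap P R p ∈ n)
    (hinj : ∀ n n' : Ideal R, n.IsMaximal → n'.IsMaximal → I ≤ n → I ≤ n' →
      n.comap (algebraMap P R) = n'.comap (algebraMap P R) → n = n') :
    Function.Surjective (algebraMap P (R ⧸ I)) := by
  set B := R ⧸ I
  have hmk : Function.Surjective (algebraMap R B) := Ideal.Quotient.mk_surjective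
  have hI (q : Ideal B) : I ≤ q.comap (algebraMap R B) := fun x hx ↦ by
    rw [Ideal.mem_comap, show algebraMap R B x = 0 from Ideal.Quotient.eq_zero_iff_mem.mpr hx]
    exact zero_mem _
  have : Algebra.FormallyUnramified P B := .of_surjective_of_forall_isMaximal hmk fun q hq ↦
    hΩ _ (Ideal.comap_isMaximal_of_surjective _ hmk) (hI q)
  change Function.Surjective (Algebra.linearMap P B)
  rw [← LinearMap.range_eq_top]
  refine Submodule.eq_top_of_forall_sup_smul_eq_top _ fun M hM ↦ ?_
  rw [Ideal.smul_top_eq_map]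
  -- Unramifiedness makes MB radical, and injectivity on closed points leaves at most one maximal
  -- ideal q above M. So MB is q or the unit ideal, and trivial residue extensions give B = P + MB.
  have hrad := Algebra.FormallyUnramified.isRadical_map_isMaximal P B M
  have hcomap (q : Ideal B) (hq : q.IsPrime) (hMq : M.map (algebraMap P B) ≤ q) :
      q.comap (algebraMap P B) = M ∧ q.IsMaximal := by
    have h1 : q.comap (algebraMap P B) = M :=
      (hM.eq_of_le (Ideal.comap_ne_top _ hq.ne_top) (Ideal.map_le_iff_le_comap.mp hMq)).symm
    exact ⟨h1, Ideal.isMaximal_of_isIntegral_of_isMaximal_comap q (h1 ▸ hM)⟩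
  rw [eq_top_iff]
  rintro x -
  by_cases htop : M.map (algebraMap P B) = ⊤
  · refine Submodule.mem_sup_right ?_
    rw [htop]; trivial
  obtain ⟨q, hq, hMq⟩ := Ideal.exists_le_maximal _ htop
  have hqM : q ≤ M.map (algebraMap P B) := by
    rw [← hrad.radical, Ideal.radical_eq_sInf]
    refine le_sInf ?_
    rintro q' ⟨hq'M, hq'⟩
    obtain ⟨h1, h2⟩ := hcomap q hq.isPrime hMq
    obtain ⟨h1', h2'⟩ := hcomap q' hq' hq'M
    have h3 := hinj (q.comap (algebraMap R B)) (q'.comap (algebraMap R B))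
      (Ideal.comap_isMaximal_of_surjective _ hmk) (Ideal.comap_isMaximal_of_surjective _ hmk)
      (hI q) (hI q') (by
        rw [Ideal.comap_comap, Ideal.comap_comap, ← IsScalarTower.algebraMap_eq, h1, h1'])
    exact (Ideal.comap_injective_of_surjective _ hmk h3).le
  obtain ⟨r, rfl⟩ := hmk x
  obtain ⟨p, hp⟩ := hres (q.comap (algebraMap R B)) (Ideal.comap_isMaximal_of_surjective _ hmk)
    (hI q) r
  have h4 : algebraMap R B r - algebraMap P B p ∈ M.map (algebraMap P B) := hqM <| by
    rw [IsScalarTower.algebraMap_apply P R B, ← map_sub]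
    exact hp
  have := add_mem (Submodule.mem_sup_left (T := (M.map (algebraMap P B)).restrictScalars P)
    (show algebraMap P B p ∈ LinearMap.range (Algebra.linearMap P B) from ⟨p, rfl⟩))
    (Submodule.mem_sup_right h4)
  simpa using this

end Surjective

/-! ### Choosing the images of the closed points -/

section ChoosePoints

open KaehlerDifferential

variable {A R σ : Type*} [CommRing A] [CommRing R] [Algebra A R]

lemma Ideal.isMaximal_under_of_finite_quotient (n : Ideal R) [n.IsMaximal]
    [Algebra.IsIntegral A (R ⧸ n)] : (n.under A).IsMaximal := by
  have h : ((⊥ : Ideal (R ⧸ n)).comap (algebraMap A (R ⧸ n))) = n.under A := by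
    rw [IsScalarTower.algebraMap_eq A R (R ⧸ n), ← Ideal.comap_comap]
    congr 1
    exact Ideal.mk_ker
  rw [← h]
  have := Ideal.bot_quotient_isMaximal_iff n |>.mpr ‹_›
  exact Ideal.isMaximal_comap_of_isIntegral_of_isMaximal _

/-- An inseparable residue field might need many generators. The bound comes from Ω[R/A], which
surjects onto the differentials of R/n over the residue field of A and needs at most as many
generators at n as there are coordinates. -/
lemma exists_mem_pointsWithResidueField_quotient_notMem [Finite σ] [Nonempty σ] (n : Ideal R)
    [n.IsMaximal] [Module.Finite A (R ⧸ n)] [Infinite (A ⧸ n.under A)] (ω : σ → Ω[R⁄A])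
    (hω : Submodule.span R (Set.range ω) ⊔ n • ⊤ = ⊤)
    (U : TopologicalSpace.Opens (PrimeSpectrum (MvPolynomial σ A)))
    (hU : ∃ x ∈ U, x.asIdeal.under A = n.under A)
    (S : Set (PrimeSpectrum (MvPolynomial σ A))) (hS : S.Finite)
    (hS' : ∀ x ∈ S, ∀ i, ∃ p : Polynomial A, p.Monic ∧
      Polynomial.aeval (MvPolynomial.X i) p ∈ x.asIdeal) :
    ∃ x ∈ pointsWithResidueField U (R ⧸ n), x ∉ S := by
  have hmax : (n.under A).IsMaximal := Ideal.isMaximal_under_of_finite_quotient n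
  let := Ideal.Quotient.field n
  let := Ideal.Quotient.field (n.under A)
  have : Module.Finite (A ⧸ n.under A) (R ⧸ n) := .of_restrictScalars_finite A _ _
  have : SMulCommClass (A ⧸ n.under A) R (R ⧸ n) := SMulCommClass.of_commMonoid _ _ _
  let f : Ω[R⁄A] →ₗ[R] Ω[R ⧸ n⁄A ⧸ n.under A] := KaehlerDifferential.map A _ R (R ⧸ n)
  have hf : Function.Surjective f :=
    map_surjective_of_surjective A _ R (R ⧸ n) Ideal.Quotient.mk_surjective
  refine exists_mem_pointsWithResidueField_notMem (k := A ⧸ n.under A) Ideal.Quotient.mk_surjective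
    (fun i ↦ f (ω i)) ?_ U ?_ S hS hS'
  · rw [← Submodule.restrictScalars_eq_top_iff R,
      Submodule.restrictScalars_span R (R ⧸ n) Ideal.Quotient.mk_surjective, eq_top_iff,
      ← LinearMap.range_eq_top.mpr hf, LinearMap.range_eq_map, ← hω, Submodule.map_sup,
      Submodule.map_span, ← Set.range_comp]
    refine sup_le le_rfl ?_
    rw [Submodule.map_smul'', Submodule.smul_le]
    intro r hr x _
    have h0 : algebraMap R (R ⧸ n) r = 0 := Ideal.Quotient.eq_zero_iff_mem.mpr hr
    rw [← algebraMap_smul (R ⧸ n) r x, h0, zero_smul]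
    exact zero_mem _
  · obtain ⟨x, hx, hx'⟩ := hU
    refine ⟨x, hx, ?_⟩
    change _ ≤ x.asIdeal.under A
    rw [hx']
    exact Ideal.mk_ker.le

lemma mem_pointsWithResidueField_quotient_iff (n : Ideal R) [n.IsMaximal] [Module.Finite A (R ⧸ n)]
    [Finite (A ⧸ n.under A)] (U : TopologicalSpace.Opens (PrimeSpectrum (MvPolynomial σ A)))
    (x : PrimeSpectrum (MvPolynomial σ A)) :
    x ∈ pointsWithResidueField U (R ⧸ n) ↔ x ∈ U ∧ x.asIdeal.under A = n.under A ∧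
      Nat.card (MvPolynomial σ A ⧸ x.asIdeal) = Nat.card (R ⧸ n) := by
  have hmax : (n.under A).IsMaximal := Ideal.isMaximal_under_of_finite_quotient n
  let := Ideal.Quotient.field n
  let := Ideal.Quotient.field (n.under A)
  have : Module.Finite (A ⧸ n.under A) (R ⧸ n) := .of_restrictScalars_finite A _ _
  constructor
  · rintro ⟨hxU, e, he, hker⟩
    refine ⟨hxU, ?_, ?_⟩
    · rw [← hker]
      ext a
      simp only [Ideal.mem_comap, RingHom.mem_ker, AlgHom.commutes]
      rw [IsScalarTower.algebraMap_apply A R (R ⧸ n)]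
      exact Ideal.Quotient.eq_zero_iff_mem
    · rw [← hker]
      exact Nat.card_congr (RingHom.quotientKerEquivOfSurjective (f := e.toRingHom) he).toEquiv
  · rintro ⟨hxU, hx, hc⟩
    have : Finite (R ⧸ n) := Module.finite_of_finite (A ⧸ n.under A)
    refine mem_pointsWithResidueField_of_natCard_eq (k := A ⧸ n.under A)
      Ideal.Quotient.mk_surjective U x hxU ?_ hc
    change _ ≤ x.asIdeal.under A
    rw [hx]
    exact Ideal.mk_ker.le

/-- If there is no finite field obstruction, the closed points of `V(I)` can be mapped injectively
to closed points of `U` with the same residue fields, with prescribed images on a subset. -/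
lemma exists_injective_mem_pointsWithResidueField [Finite σ] [Nonempty σ]
    (U : TopologicalSpace.Opens (PrimeSpectrum (MvPolynomial σ A)))
    (hU : ∀ m : Ideal A, m.IsMaximal → ∃ x ∈ U, x.asIdeal.under A = m) {T : Type*} [Finite T]
    (n : T → Ideal R) [∀ t, (n t).IsMaximal] [∀ t, Module.Finite A (R ⧸ n t)]
    (hω : ∀ t, ∃ ω : σ → Ω[R⁄A], Submodule.span R (Set.range ω) ⊔ n t • ⊤ = ⊤)
    (hcount : ∀ m : Ideal A, m.IsMaximal → Finite (A ⧸ m) → ∀ N : ℕ, 2 ≤ N →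
      {t | (n t).under A = m ∧ Nat.card (R ⧸ n t) = N}.encard ≤
      {x | x ∈ U ∧ x.asIdeal.under A = m ∧ Nat.card (MvPolynomial σ A ⧸ x.asIdeal) = N}.encard)
    (T₀ : Set T) (u₀ : T → PrimeSpectrum (MvPolynomial σ A)) (hinj : Set.InjOn u₀ T₀)
    (hmem : ∀ t ∈ T₀, u₀ t ∈ pointsWithResidueField U (R ⧸ n t)) :
    ∃ u : T → PrimeSpectrum (MvPolynomial σ A), Function.Injective u ∧
      (∀ t, u t ∈ pointsWithResidueField U (R ⧸ n t)) ∧ ∀ t ∈ T₀, u t = u₀ t := by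
  refine exists_injective_extension _ T₀ u₀ hinj hmem fun T₁ u t ht _ huinj humem ↦ ?_
  have hmax : ((n t).under A).IsMaximal := Ideal.isMaximal_under_of_finite_quotient (n t)
  rcases finite_or_infinite (A ⧸ (n t).under A) with hfin | hinf
  · by_contra! H
    let := Ideal.Quotient.field (n t)
    have : Module.Finite (A ⧸ (n t).under A) (R ⧸ n t) := .of_restrictScalars_finite A _ _
    have : Finite (R ⧸ n t) := Module.finite_of_finite (A ⧸ (n t).under A)
    have hle := hcount _ hmax hfin (Nat.card (R ⧸ n t)) Finite.one_lt_card
    set V := {s | (n s).under A = (n t).under A ∧ Nat.card (R ⧸ n s) = Nat.card (R ⧸ n t)}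
    have htV : t ∈ V := ⟨rfl, rfl⟩
    -- If every candidate were taken, then each would be the image of some s ∈ T₁ with the same base
    -- point and residue cardinality as t, and s ≠ t. There would be at most |V| - 1 candidates,
    -- whereas the hypothesis gives at least |V|.
    have hsub : {x | x ∈ U ∧ x.asIdeal.under A = (n t).under A ∧
        Nat.card (MvPolynomial σ A ⧸ x.asIdeal) = Nat.card (R ⧸ n t)} ⊆ u '' (V \ {t}) := by
      intro x hx
      obtain ⟨s, hs, rfl⟩ := H x ((mem_pointsWithResidueField_quotient_iff (n t) U x).mpr hx)
      have hs' := humem s hs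
      have hu : (n s).under A = (n t).under A := by
        obtain ⟨-, e, -, he⟩ := hs'
        rw [← hx.2.1, ← he]
        ext a
        simp only [Ideal.mem_comap, RingHom.mem_ker, AlgHom.commutes]
        rw [IsScalarTower.algebraMap_apply A R (R ⧸ n s)]
        exact Ideal.Quotient.eq_zero_iff_mem.symm
      have : Finite (A ⧸ (n s).under A) := hu ▸ hfin
      have h2 := (mem_pointsWithResidueField_quotient_iff (n s) U _).mp hs'
      exact ⟨s, ⟨⟨hu, h2.2.2.symm.trans hx.2.2⟩, fun h ↦ ht (h ▸ hs)⟩, rfl⟩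
    have h1 := (hle.trans (Set.encard_le_encard hsub)).trans (Set.encard_image_le u _)
    rw [← Set.encard_sdiff_singleton_add_one htV] at h1
    have hfinV : (V \ {t}).Finite := Set.toFinite _
    rw [hfinV.encard_eq_coe_toFinset_card] at h1
    norm_cast at h1
    omega
  · obtain ⟨ω, hω⟩ := hω t
    refine exists_mem_pointsWithResidueField_quotient_notMem (n t) ω hω U (hU _ hmax) _
      (Set.toFinite _) ?_
    rintro _ ⟨s, hs, rfl⟩
    exact exists_monic_of_mem_pointsWithResidueField (humem s hs)

end ChoosePoints

/-! ### The embedding of a finite closed subscheme of a smooth affine scheme -/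

section Core

open KaehlerDifferential

variable {A R σ : Type*} [CommRing A] [CommRing R] [Algebra A R]

/-- R/I is quasi-finite over A and its maximal ideals lie over the finitely many maximal ideals of
A. -/
lemma finite_isMaximal_of_finite_quotient [Finite (MaximalSpectrum A)] (I : Ideal R)
    [Module.Finite A (R ⧸ I)] : {n : Ideal R | n.IsMaximal ∧ I ≤ n}.Finite := by
  have h1 : (Set.range (MaximalSpectrum.toPrimeSpectrum (R := A))).Finite := Set.finite_range _
  refine ((Algebra.QuasiFinite.finite_comap_preimage (S := R ⧸ I) h1).image
    fun q ↦ q.asIdeal.comap (Ideal.Quotient.mk I)).subset ?_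
  rintro n ⟨hn, hI⟩
  have hmap : (n.map (Ideal.Quotient.mk I)).IsMaximal :=
    Ideal.IsMaximal.map_of_surjective_of_ker_le Ideal.Quotient.mk_surjective
      (by rwa [Ideal.mk_ker])
  refine ⟨⟨_, hmap.isPrime⟩, ⟨⟨_, Ideal.isMaximal_comap_of_isIntegral_of_isMaximal _⟩, rfl⟩, ?_⟩
  change (n.map (Ideal.Quotient.mk I)).comap (Ideal.Quotient.mk I) = n
  rw [Ideal.comap_map_of_surjective _ Ideal.Quotient.mk_surjective, ← RingHom.ker_eq_comap_bot,
    Ideal.mk_ker, sup_eq_left.mpr hI]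

variable [Finite σ] [Nonempty σ] [Finite (MaximalSpectrum A)]

/-- Choice of the coordinates of the embedding. -/
lemma exists_aeval_of_forall_isMaximal
    (U : TopologicalSpace.Opens (PrimeSpectrum (MvPolynomial σ A)))
    (hU : ∀ m : Ideal A, m.IsMaximal → ∃ x ∈ U, x.asIdeal.under A = m)
    (I J : Ideal R) [Module.Finite A (R ⧸ I)]
    (hω : ∀ n : Ideal R, n.IsMaximal → I ≤ n →
      ∃ ω : σ → Ω[R⁄A], Submodule.span R (Set.range ω) ⊔ n • ⊤ = ⊤)
    (hcount : ∀ m : Ideal A, m.IsMaximal → Finite (A ⧸ m) → ∀ N : ℕ, 2 ≤ N →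
      {n : PrimeSpectrum R | I ≤ n.asIdeal ∧ n.asIdeal.under A = m ∧
        Nat.card (R ⧸ n.asIdeal) = N}.encard ≤
      {x | x ∈ U ∧ x.asIdeal.under A = m ∧ Nat.card (MvPolynomial σ A ⧸ x.asIdeal) = N}.encard)
    (y : MvPolynomial σ A →ₐ[A] R ⧸ J) (hy : Function.Surjective y)
    (hyU : ∀ q : PrimeSpectrum (R ⧸ J), PrimeSpectrum.comap y.toRingHom q ∈ U) :
    ∃ a : σ → R, (Ideal.Quotient.mkₐ A J).comp (MvPolynomial.aeval a) = y ∧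
      (∀ n : Ideal R, n.IsMaximal → I ≤ n →
        Submodule.span R (Set.range fun i ↦ D A R (a i)) ⊔ n • ⊤ = ⊤) ∧
      (∀ n : Ideal R, n.IsMaximal → I ≤ n → ∀ r : R, ∃ p, r - MvPolynomial.aeval (R := A) a p ∈ n) ∧
      (∀ n n' : Ideal R, n.IsMaximal → n'.IsMaximal → I ≤ n → I ≤ n' →
        n.comap (MvPolynomial.aeval (R := A) a) = n'.comap (MvPolynomial.aeval a) → n = n') ∧
      ∀ n : PrimeSpectrum R, n.asIdeal.IsMaximal → I ≤ n.asIdeal →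
        PrimeSpectrum.comap (MvPolynomial.aeval (R := A) a).toRingHom n ∈ U := by
  classical
  let T := {n : Ideal R // n.IsMaximal ∧ I ≤ n}
  have hT : Finite T := finite_isMaximal_of_finite_quotient (A := A) I
  let n : T → Ideal R := Subtype.val
  have hnmax (t : T) : (n t).IsMaximal := t.2.1
  have hnfin (t : T) : Module.Finite A (R ⧸ n t) :=
    .of_surjective (Ideal.Quotient.factorₐ A t.2.2).toLinearMap (Ideal.Quotient.factor_surjective t.2.2)
  have hninj : Function.Injective n := Subtype.val_injective
  -- the prescribed images
  let f₀ (t : T) (h : J ≤ n t) : MvPolynomial σ A →ₐ[A] R ⧸ n t :=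
    (Ideal.Quotient.factorₐ A h).comp y
  have hf₀ (t : T) (h : J ≤ n t) : Function.Surjective (f₀ t h) :=
    (Ideal.Quotient.factor_surjective h).comp hy
  let u₀ (t : T) : PrimeSpectrum (MvPolynomial σ A) :=
    if h : J ≤ n t then ⟨RingHom.ker (f₀ t h), RingHom.ker_isPrime _⟩
    -- An arbitrary default: nothing is required of u₀ away from the points of V(J).
    else PrimeSpectrum.comap (MvPolynomial.aeval (R := A) (0 : σ → R)).toRingHom
      ⟨n t, (hnmax t).isPrime⟩
  have hu₀ (t : T) (h : J ≤ n t) : (u₀ t).asIdeal = RingHom.ker (f₀ t h) := by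
    simp only [u₀, dif_pos h]
  have hker (t : T) (h : J ≤ n t) (r : R) (p : MvPolynomial σ A) (hp : y p = Ideal.Quotient.mk J r) :
      p ∈ (u₀ t).asIdeal ↔ r ∈ n t := by
    rw [hu₀ t h, RingHom.mem_ker, AlgHom.comp_apply, hp, Ideal.Quotient.factorₐ_apply_mk,
      Ideal.Quotient.eq_zero_iff_mem]
  obtain ⟨u, huinj, humem, huu₀⟩ := exists_injective_mem_pointsWithResidueField U hU n
    (fun t ↦ hω _ t.2.1 t.2.2) (fun m hm hfin N hN ↦ by
      refine le_trans ?_ (hcount m hm hfin N hN)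
      let v (t : T) : PrimeSpectrum R := ⟨n t, (hnmax t).isPrime⟩
      have hv : Function.Injective v := fun s t hst ↦ hninj (congr_arg PrimeSpectrum.asIdeal hst)
      rw [← hv.encard_image]
      refine Set.encard_le_encard ?_
      rintro _ ⟨t, ht, rfl⟩
      exact ⟨t.2.2, ht⟩) {t | J ≤ n t} u₀ (by
      intro s hs t ht hst
      apply hninj
      ext r
      obtain ⟨p, hp⟩ := hy (Ideal.Quotient.mk J r)
      rw [← hker s hs r p hp, ← hker t ht r p hp, hst]) (by
      intro t ht
      refine ⟨?_, f₀ t ht, hf₀ t ht, (hu₀ t ht).symm⟩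
      convert! hyU (PrimeSpectrum.comap (Ideal.Quotient.factor ht) ⟨⊥, Ideal.isPrime_bot⟩)
      ext p
      rw [hu₀ t ht]
      rfl)
  choose e he hek using fun t ↦ (humem t).2
  -- first approximation
  let ι := Option {t : T // ¬ J ≤ n t}
  let f : ι → Ideal R := fun j ↦ j.elim J fun t ↦ n t.1
  -- One ideal for the prescribed part V(J) and one for each closed point outside it. Points inside
  -- V(J) need no ideal of their own, since y already fixes their images.
  have hcop : Pairwise (Function.onFun IsCoprime f) := by
    have key (t : T) (h : ¬ J ≤ n t) : J ⊔ n t = ⊤ := by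
      by_contra hne
      have h1 := (hnmax t).eq_of_le hne le_sup_right
      exact h (le_sup_left.trans h1.ge)
    rintro (_ | s) (_ | t) hst
    · exact (hst rfl).elim
    · exact Ideal.isCoprime_iff_sup_eq.mpr (key t.1 t.2)
    · exact (Ideal.isCoprime_iff_sup_eq.mpr (key s.1 s.2)).symm
    · refine Ideal.isCoprime_iff_sup_eq.mpr (Ideal.IsMaximal.coprime_of_ne (hnmax _) (hnmax _) ?_)
      exact hninj.ne fun h ↦ hst (congr_arg some (Subtype.ext h))
  have htarget (i : σ) : ∃ g : ι → R, Ideal.Quotient.mk J (g none) = y (MvPolynomial.X i) ∧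
      ∀ t, Ideal.Quotient.mk (n t.1) (g (some t)) = e t.1 (MvPolynomial.X i) := by
    choose g hg using fun t : {t : T // ¬ J ≤ n t} ↦
      Ideal.Quotient.mk_surjective (e t.1 (MvPolynomial.X i))
    obtain ⟨r, hr⟩ := Ideal.Quotient.mk_surjective (y (MvPolynomial.X i))
    exact ⟨fun j ↦ j.elim r g, hr, hg⟩
  choose g hg hg' using htarget
  choose c hc using fun i ↦ Ideal.exists_forall_sub_mem_ideal hcop (g i)
  -- the values of `c` and of any modification
  have hmod (δ : σ → R) (hδ : ∀ i, δ i ∈ ⨅ j, f j) :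
      (Ideal.Quotient.mkₐ A J).comp (MvPolynomial.aeval (c + δ)) = y ∧
      ∀ t, ¬ J ≤ n t → (Ideal.Quotient.mkₐ A (n t)).comp (MvPolynomial.aeval (c + δ)) = e t := by
    have hδ' (i j) : δ i ∈ f j := (Ideal.mem_iInf.mp (hδ i)) j
    refine ⟨MvPolynomial.algHom_ext fun i ↦ ?_, fun t ht ↦ MvPolynomial.algHom_ext fun i ↦ ?_⟩
    · rw [← hg, AlgHom.comp_apply, MvPolynomial.aeval_X, Ideal.Quotient.mkₐ_eq_mk,
        Ideal.Quotient.mk_eq_mk_iff_sub_mem, Pi.add_apply, add_sub_right_comm]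
      exact add_mem (hc i none) (hδ' i none)
    · rw [← hg' i ⟨t, ht⟩, AlgHom.comp_apply, MvPolynomial.aeval_X, Ideal.Quotient.mkₐ_eq_mk,
        Ideal.Quotient.mk_eq_mk_iff_sub_mem, Pi.add_apply, add_sub_right_comm]
      exact add_mem (hc i (some ⟨t, ht⟩)) (hδ' i (some ⟨t, ht⟩))
  have happrox (δ : σ → R) (hδ : ∀ i, δ i ∈ ⨅ j, f j) (t : T) :
      ∃ j, f j ≤ n t ∧ ∀ r : R, ∃ p, r - MvPolynomial.aeval (R := A) (c + δ) p ∈ f j := by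
    obtain ⟨h1, h2⟩ := hmod δ hδ
    by_cases ht : J ≤ n t
    · refine ⟨none, ht, fun r ↦ ?_⟩
      obtain ⟨p, hp⟩ := hy (Ideal.Quotient.mk J r)
      exact ⟨p, (Ideal.Quotient.mk_eq_mk_iff_sub_mem _ _).mp
        (hp.symm.trans (DFunLike.congr_fun h1 p).symm)⟩
    · refine ⟨some ⟨t, ht⟩, le_rfl, fun r ↦ ?_⟩
      obtain ⟨p, hp⟩ := he t (Ideal.Quotient.mk (n t) r)
      exact ⟨p, (Ideal.Quotient.mk_eq_mk_iff_sub_mem _ _).mp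
        (hp.symm.trans (DFunLike.congr_fun (h2 t ht) p).symm)⟩
  have hle (t : T) : ⨅ j, f j ≤ n t := by
    obtain ⟨j, hj, -⟩ := happrox 0 (fun _ ↦ zero_mem _) t
    exact (iInf_le f j).trans hj
  obtain ⟨δ, hδ, hspan⟩ := (D A R).exists_span_range_D_add_eq_top n hninj (⨅ j, f j) hle c
    (fun t ↦ hω _ t.2.1 t.2.2) fun t ↦ by
      refine (D A R).span_range_D_sup_span_image_eq_top (span_range_derivation A R) (n t) _ (hle t)
        c fun r ↦ ?_
      obtain ⟨j, hj, hj'⟩ := happrox 0 (fun _ ↦ zero_mem _) t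
      obtain ⟨p, hp⟩ := hj' r
      rw [add_zero] at hp
      -- s is 1 modulo f j and 0 modulo the other ideals. It turns an approximation modulo f j into
      -- one modulo the whole intersection, and it is not in n t because f j ≤ n t.
      obtain ⟨s, hs⟩ := Ideal.exists_forall_sub_mem_ideal hcop (fun i ↦ if i = j then (1 : R) else 0)
      refine ⟨p, s, fun h ↦ (hnmax t).ne_top ?_, Ideal.mem_iInf.mpr fun i ↦ ?_⟩
      · rw [Ideal.eq_top_iff_one]
        have h3 := hs j
        rw [if_pos rfl] at h3
        simpa using sub_mem h (hj h3)
      · by_cases hij : i = j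
        · subst hij; exact Ideal.mul_mem_left _ _ hp
        · have h3 := hs i
          rw [if_neg hij, sub_zero] at h3
          exact Ideal.mul_mem_right _ _ h3
  have hcomap (t : T) : (n t).comap (MvPolynomial.aeval (R := A) (c + δ)) = (u t).asIdeal := by
    obtain ⟨h1, h2⟩ := hmod δ hδ
    ext p
    by_cases ht : J ≤ n t
    · rw [huu₀ t ht, hker t ht (MvPolynomial.aeval (c + δ) p) p (by rw [← h1]; rfl)]
      rfl
    · rw [← hek, RingHom.mem_ker, ← h2 t ht]
      exact (Ideal.Quotient.eq_zero_iff_mem (I := n t)).symm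
  refine ⟨c + δ, (hmod δ hδ).1, fun m hm hI ↦ hspan ⟨m, hm, hI⟩, fun m hm hI r ↦ ?_,
    fun m m' hm hm' hI hI' h ↦ ?_, fun m hm hI ↦ ?_⟩
  · obtain ⟨j, hj, hj'⟩ := happrox δ hδ ⟨m, hm, hI⟩
    obtain ⟨p, hp⟩ := hj' r
    exact ⟨p, hj hp⟩
  · have h1 : u ⟨m, hm, hI⟩ = u ⟨m', hm', hI'⟩ := by
      ext1
      rw [← hcomap, ← hcomap]
      exact h
    exact congr_arg Subtype.val (huinj h1)
  · convert! (humem ⟨m.asIdeal, hm, hI⟩).1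
    ext1
    exact hcomap ⟨m.asIdeal, hm, hI⟩

end Core

/-! ### Étale coordinates that embed a finite closed subscheme -/

section EtaleCoordinates

/-- V(I) misses the complement V(s) of O, as a common point would specialize to a closed one.
Writing 1 = x + g with x ∈ I and g in the ideal of s gives the function g. -/
lemma Ideal.exists_basicOpen_le_of_forall_isMaximal {R : Type*} [CommRing R] (I : Ideal R)
    {O : Set (PrimeSpectrum R)} (hO : IsOpen O)
    (h : ∀ n : PrimeSpectrum R, n.asIdeal.IsMaximal → I ≤ n.asIdeal → n ∈ O) :
    ∃ g : R, g - 1 ∈ I ∧ (PrimeSpectrum.basicOpen g : Set (PrimeSpectrum R)) ⊆ O := by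
  obtain ⟨s, hs⟩ := (PrimeSpectrum.isOpen_iff _).mp hO
  have htop : I ⊔ Ideal.span s = ⊤ := by
    by_contra hne
    obtain ⟨n, hn, hle⟩ := Ideal.exists_le_maximal _ hne
    have hmem := h ⟨n, hn.isPrime⟩ hn (le_sup_left.trans hle)
    have : (⟨n, hn.isPrime⟩ : PrimeSpectrum R) ∈ Oᶜ := by
      rw [hs, PrimeSpectrum.mem_zeroLocus]
      exact Ideal.span_le.mp (le_sup_right.trans hle)
    exact this hmem
  obtain ⟨x, hx, g, hg, hxg⟩ := Submodule.mem_sup.mp (htop ▸ Submodule.mem_top (x := (1 : R)))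
  refine ⟨g, ?_, fun p hp ↦ ?_⟩
  · rw [show g - 1 = -x by linear_combination hxg]
    exact neg_mem hx
  · by_contra hpO
    have : p ∈ Oᶜ := hpO
    rw [hs, PrimeSpectrum.mem_zeroLocus] at this
    exact hp (Ideal.span_le.mpr this hg)

open MvPolynomial KaehlerDifferential

variable {A R σ : Type*} [CommRing A] [CommRing R] [Algebra A R]

/-- The affine form of the embedding. The étale locus and the preimage of U are open and contain all
closed points of V(I), so a basic open with g ≡ 1 modulo I lies in both and still contains V(I). -/
theorem exists_aeval_surjective_and_etale [Finite σ] [Nonempty σ] [Finite (MaximalSpectrum A)]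
    [Algebra.Smooth A R] (U : TopologicalSpace.Opens (PrimeSpectrum (MvPolynomial σ A)))
    (hU : ∀ m : Ideal A, m.IsMaximal → ∃ x ∈ U, x.asIdeal.under A = m)
    (I J : Ideal R) [Module.Finite A (R ⧸ I)]
    (hb : ∀ (n : Ideal R) [n.IsMaximal], I ≤ n →
      Nonempty (Module.Basis σ (Localization.AtPrime n) (Ω[Localization.AtPrime n⁄A])))
    (hcount : ∀ m : Ideal A, m.IsMaximal → Finite (A ⧸ m) → ∀ N, 2 ≤ N →
      {n : PrimeSpectrum R | I ≤ n.asIdeal ∧ n.asIdeal.under A = m ∧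
        Nat.card (R ⧸ n.asIdeal) = N}.encard ≤
      {x | x ∈ U ∧ x.asIdeal.under A = m ∧
        Nat.card (MvPolynomial σ A ⧸ x.asIdeal) = N}.encard)
    (y : MvPolynomial σ A →ₐ[A] R ⧸ J) (hy : Function.Surjective y)
    (hyU : ∀ q, PrimeSpectrum.comap y.toRingHom q ∈ U) :
    ∃ (φ : MvPolynomial σ A →ₐ[A] R) (g : R), (Ideal.Quotient.mkₐ A J).comp φ = y ∧
      Function.Surjective ((Ideal.Quotient.mkₐ A I).comp φ) ∧ g - 1 ∈ I ∧
      (∀ p ∈ PrimeSpectrum.basicOpen g, PrimeSpectrum.comap φ.toRingHom p ∈ U) ∧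
      ((algebraMap R (Localization.Away g)).comp φ.toRingHom).Etale := by
  obtain ⟨a, hay, hspan, hres, hinj, hmem⟩ := exists_aeval_of_forall_isMaximal U hU I J
    (fun n hn hle ↦ (hb n hle).elim fun b ↦ exists_span_range_sup_smul_eq_top n b) hcount y hy hyU
  set φ : MvPolynomial σ A →ₐ[A] R := aeval a with hφ
  let : Algebra (MvPolynomial σ A) R := φ.toRingHom.toAlgebra
  have : IsScalarTower A (MvPolynomial σ A) R := .of_algebraMap_eq' φ.comp_algebraMap.symm
  have hX : ∀ i, algebraMap (MvPolynomial σ A) R (X i) = a i := fun i ↦ aeval_X a i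
  have : Module.Finite (MvPolynomial σ A) (R ⧸ I) := .of_restrictScalars_finite A _ _
  have hsurj : Function.Surjective (algebraMap (MvPolynomial σ A) (R ⧸ I)) := by
    refine Ideal.Quotient.algebraMap_surjective_of_forall_isMaximal I (fun n hn hle ↦ ?_) hres hinj
    have := congr_arg (Submodule.map (KaehlerDifferential.map A (MvPolynomial σ A) R R))
      (hspan n hn hle)
    rw [Submodule.map_sup, Submodule.map_top, LinearMap.range_eq_top.mpr
      (KaehlerDifferential.map_surjective A (MvPolynomial σ A) R), Submodule.map_smul'',
      Submodule.map_top, LinearMap.range_eq_top.mpr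
      (KaehlerDifferential.map_surjective A (MvPolynomial σ A) R)] at this
    refine this.ge.trans (sup_le ?_ le_rfl)
    rw [Submodule.map_span, Submodule.span_le]
    rintro _ ⟨_, ⟨i, rfl⟩, rfl⟩
    have h0 : KaehlerDifferential.map A (MvPolynomial σ A) R R (D A R (a i)) = 0 := by
      rw [KaehlerDifferential.map_D, Algebra.algebraMap_self_apply, ← hX, Derivation.map_algebraMap]
    rw [SetLike.mem_coe, h0]
    exact zero_mem _
  have : Algebra.FinitePresentation (MvPolynomial σ A) R :=
    .of_restrict_scalars_finitePresentation A _ _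
  have hcont : Continuous (PrimeSpectrum.comap φ.toRingHom) := PrimeSpectrum.continuous_comap _
  obtain ⟨g, hg, hgO⟩ := Ideal.exists_basicOpen_le_of_forall_isMaximal I
    ((Algebra.isOpen_etaleLocus (R := MvPolynomial σ A) (A := R)).inter (U.2.preimage hcont))
    fun n hn hle ↦ ⟨by
      obtain ⟨b⟩ := hb n.asIdeal hle
      refine MvPolynomial.isEtaleAt_of_span_range_D_sup_smul_eq_top n.asIdeal b ?_
      simp_rw [hX]
      exact hspan n.asIdeal hn hle, hmem n hn hle⟩
  refine ⟨φ, g, hay, hsurj, hg, fun p hp ↦ (hgO hp).2, ?_⟩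
  have := Algebra.basicOpen_subset_etaleLocus_iff_etale.mp (hgO.trans Set.inter_subset_left)
  rw [← RingHom.etale_algebraMap] at this
  exact this

end EtaleCoordinates

/-! ### Counting points of fibres with given residue field cardinality -/

section Counting

lemma AlgebraicGeometry.natCard_residueField_of_isPreimmersion {X Y : Scheme.{u}} (f : X ⟶ Y)
    [IsPreimmersion f] (x : X) :
    Nat.card (X.residueField x) = Nat.card (Y.residueField (f x)) := by
  refine (Nat.card_eq_of_bijective (f.residueFieldMap x).hom ⟨RingHom.injective _, ?_⟩).symm
  have h : Function.Surjective (f.stalkMap x ≫ X.residue x).hom :=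
    (X.residue_surjective x).comp (f.stalkMap_surjective x)
  rw [← Scheme.residue_residueFieldMap, CommRingCat.hom_comp, RingHom.coe_comp] at h
  exact Function.Surjective.of_comp h

lemma RingHom.finrank_eq_iff_natCard_eq_pow {K L : Type*} [Field K] [Field L] [_root_.Finite K]
    (f : K →+* L) {n : ℕ} (hn : 1 ≤ n) :
    @Module.finrank K L _ _ f.toAlgebra.toModule = n ↔ Nat.card L = Nat.card K ^ n := by
  let := f.toAlgebra
  change Module.finrank K L = n ↔ _
  by_cases h : Module.Finite K L
  · rw [Module.natCard_eq_pow_finrank (K := K) (V := L)]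
    exact (Nat.pow_right_injective Finite.one_lt_card).eq_iff.symm
  · have : Infinite L := by
      by_contra hL
      have : _root_.Finite L := not_infinite_iff_finite.mp hL
      -- In infinite degree both sides are false: `finrank` and `Nat.card L` take the value 0, while
      -- n ≥ 1 and the power is positive.
      exact h inferInstance
    rw [Module.finrank_of_not_finite h, Nat.card_eq_zero_of_infinite]
    have : 0 < Nat.card K ^ n := pow_pos Nat.card_pos n
    lia

lemma mem_fibrePointsOfDegree_iff {X S : Scheme.{u}} (g : X ⟶ S) (s : S)
    [Finite (S.residueField s)] {n : ℕ} (hn : 1 ≤ n) (x : g.fiber s) :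
    x ∈ fibrePointsOfDegree g s n ↔
      Nat.card (X.residueField (g.fiberι s x)) = Nat.card (S.residueField s) ^ n := by
  have hs : Nat.card ((Spec (S.residueField s)).residueField (g.fiberToSpecResidueField s x)) =
      Nat.card (S.residueField s) := by
    rw [natCard_residueField_of_isPreimmersion (S.fromSpecResidueField s),
      S.fromSpecResidueField_apply]
  have : Finite ((Spec (S.residueField s)).residueField (g.fiberToSpecResidueField s x)) :=
    Nat.finite_of_card_ne_zero (hs ▸ Nat.card_pos.ne')
  rw [← natCard_residueField_of_isPreimmersion (g.fiberι s), ← hs]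
  exact RingHom.finrank_eq_iff_natCard_eq_pow _ hn

lemma encard_fibrePointsOfDegree {X S : Scheme.{u}} (g : X ⟶ S) (s : S)
    [Finite (S.residueField s)] {n : ℕ} (hn : 1 ≤ n) :
    (fibrePointsOfDegree g s n).encard =
      {x : X | g x = s ∧ Nat.card (X.residueField x) = Nat.card (S.residueField s) ^ n}.encard := by
  rw [← (g.fiberι s).isEmbedding.injective.encard_image]
  congr 1
  ext x
  constructor
  · rintro ⟨y, hy, rfl⟩
    refine ⟨?_, (mem_fibrePointsOfDegree_iff g s hn y).mp hy⟩
    have : g.fiberι s y ∈ Set.range (g.fiberι s) := ⟨y, rfl⟩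
    rwa [g.range_fiberι] at this
  · rintro ⟨hx, hc⟩
    have : x ∈ Set.range (g.fiberι s) := by rwa [g.range_fiberι]
    obtain ⟨y, rfl⟩ := this
    exact ⟨y, (mem_fibrePointsOfDegree_iff g s hn y).mpr hc, rfl⟩

/-- There is no finite field obstruction to embedding a subscheme. -/
lemma NoFiniteFieldObstruction.of_isPreimmersion {A : Type u} [CommRing A] {Z X : Scheme.{u}}
    (ι : Z ⟶ X) [IsPreimmersion ι] (x : X ⟶ Spec (CommRingCat.of A)) :
    NoFiniteFieldObstruction (ι ≫ x) x := by
  intro m hm n hn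
  rw [encard_fibrePointsOfDegree _ _ hn, encard_fibrePointsOfDegree _ _ hn,
    ← ι.isEmbedding.injective.encard_image]
  refine Set.encard_le_encard ?_
  rintro _ ⟨y, ⟨hy, hc⟩, rfl⟩
  exact ⟨by simpa using hy, by rw [← natCard_residueField_of_isPreimmersion ι, hc]⟩

lemma Ideal.natCard_residueField_eq {R : Type*} [CommRing R] (p : Ideal R) [p.IsPrime] :
    Nat.card p.ResidueField = Nat.card (R ⧸ p) := by
  have hinj := IsFractionRing.injective (R ⧸ p) p.ResidueField
  cases finite_or_infinite (R ⧸ p) with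
  | inl h =>
    have hp : p.IsMaximal := Ideal.Quotient.maximal_of_isField p (Finite.isField_of_domain (R ⧸ p))
    exact (Nat.card_eq_of_bijective _ p.bijective_algebraMap_quotient_residueField).symm
  | inr h =>
    have : Infinite p.ResidueField := .of_injective _ hinj
    rw [Nat.card_eq_zero_of_infinite, Nat.card_eq_zero_of_infinite]

lemma AlgebraicGeometry.natCard_residueField_Spec {R : CommRingCat.{u}} (p : Spec R) :
    Nat.card ((Spec R).residueField p) = Nat.card (R ⧸ p.asIdeal) := by
  have : p.asIdeal.IsPrime := PrimeSpectrum.isPrime p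
  exact (Nat.card_congr (Scheme.Spec.residueFieldIso R p).commRingCatIsoToRingEquiv.toEquiv).trans
    (Ideal.natCard_residueField_eq p.asIdeal)

end Counting

/-! ### Differentials of smooth algebras of constant relative dimension -/

section SmoothBasis

open KaehlerDifferential TensorProduct

variable {A R : Type u} [CommRing A] [CommRing R] [Algebra A R]

/-- Differentials of R_g are free of rank d by standard smoothness, and those of the local ring at n
are their base change because R_g → R_n is formally étale. -/
lemma KaehlerDifferential.nonempty_basis_localization_of_isStandardSmooth {σ : Type*} [Finite σ]
    (n : Ideal R) [n.IsPrime] {g : R} (hg : g ∉ n)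
    [Algebra.IsStandardSmoothOfRelativeDimension (Nat.card σ) A (Localization.Away g)] :
    Nonempty (Module.Basis σ (Localization.AtPrime n) (Ω[Localization.AtPrime n⁄A])) := by
  set S := Localization.Away g
  set T := Localization.AtPrime n
  have hu : IsUnit (algebraMap R T g) := IsLocalization.map_units T (⟨g, hg⟩ : n.primeCompl)
  let f : S →ₐ[R] T := IsLocalization.liftAlgHom (M := Submonoid.powers g) (f := Algebra.ofId R T)
    (by rintro ⟨_, k, rfl⟩; simpa using hu.pow k)
  let : Algebra S T := f.toRingHom.toAlgebra
  have : IsScalarTower R S T := .of_algebraMap_eq' f.comp_algebraMap.symm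
  have : IsScalarTower A S T := .to₁₃₄ A R S T
  have : Algebra.FormallyEtale R S := .of_isLocalization (Submonoid.powers g)
  have : Algebra.FormallyEtale R T := .of_isLocalization n.primeCompl
  have : Algebra.FormallyEtale S T := .of_restrictScalars (R := R)
  have : Nontrivial S := f.toRingHom.domain_nontrivial
  have : Algebra.IsStandardSmooth A S :=
    Algebra.IsStandardSmoothOfRelativeDimension.isStandardSmooth (Nat.card σ)
  have hrank : Module.rank S (Ω[S⁄A]) = Nat.card σ :=
    Algebra.IsStandardSmoothOfRelativeDimension.rank_kaehlerDifferential _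
  have : Module.Finite S (Ω[S⁄A]) := inferInstance
  have hfin : Module.finrank S (Ω[S⁄A]) = Nat.card σ := Module.finrank_eq_of_rank_eq hrank
  let b : Module.Basis σ S (Ω[S⁄A]) :=
    (Module.finBasisOfFinrankEq S (Ω[S⁄A]) hfin).reindex (Finite.equivFin σ).symm
  exact ⟨(b.baseChange T).map (KaehlerDifferential.tensorKaehlerEquivOfFormallyEtale A S T)⟩

lemma KaehlerDifferential.nonempty_basis_localization_of_locally {σ : Type*} [Finite σ]
    (h : RingHom.Locally (RingHom.IsStandardSmoothOfRelativeDimension (Nat.card σ))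
      (algebraMap A R)) (n : Ideal R) [n.IsPrime] :
    Nonempty (Module.Basis σ (Localization.AtPrime n) (Ω[Localization.AtPrime n⁄A])) := by
  obtain ⟨s, hs, h⟩ := h
  obtain ⟨g, hgs, hgn⟩ : ∃ g ∈ s, g ∉ n := by
    by_contra! hle
    exact ‹n.IsPrime›.ne_top (top_le_iff.mp (hs ▸ Ideal.span_le.mpr hle))
  have hst := h g hgs
  rw [← IsScalarTower.algebraMap_eq, RingHom.isStandardSmoothOfRelativeDimension_algebraMap] at hst
  exact nonempty_basis_localization_of_isStandardSmooth n hgn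

lemma AlgebraicGeometry.smoothOfRelativeDimension_Spec_map_iff (d : ℕ) {S T : CommRingCat.{u}}
    (f : S ⟶ T) : SmoothOfRelativeDimension d (Spec.map f) ↔
      RingHom.Locally (RingHom.IsStandardSmoothOfRelativeDimension d) f.hom :=
  HasRingHomProperty.Spec_iff

lemma MvPolynomial.isStandardSmoothOfRelativeDimension (σ : Type*) [Finite σ] :
    Algebra.IsStandardSmoothOfRelativeDimension (Nat.card σ) A (MvPolynomial σ A) := by
  let G : Algebra.Generators A (MvPolynomial σ A) σ :=
    .ofSurjective MvPolynomial.X (by simpa using Function.surjective_id)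
  let Q : Algebra.PreSubmersivePresentation A (MvPolynomial σ A) σ PEmpty.{1} :=
    { toGenerators := G
      relation := PEmpty.elim
      span_range_relation_eq_ker := by
        rw [Set.range_eq_empty, Ideal.span_empty, Algebra.Generators.ker_eq_ker_aeval_val]
        change ⊥ = RingHom.ker (MvPolynomial.aeval (R := A) (MvPolynomial.X (R := A) (σ := σ)))
        rw [MvPolynomial.aeval_X_left]
        exact ((RingHom.injective_iff_ker_eq_bot _).mp Function.injective_id).symm
      map := PEmpty.elim
      map_inj := Function.injective_of_subsingleton _ }
  let Q' : Algebra.SubmersivePresentation A (MvPolynomial σ A) σ PEmpty.{1} :=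
    { __ := Q
      jacobian_isUnit := by
        classical
        rw [Algebra.PreSubmersivePresentation.jacobian_eq_jacobiMatrix_det, Matrix.det_isEmpty,
          map_one]
        exact isUnit_one }
  exact Q'.isStandardSmoothOfRelativeDimension (by simp [Algebra.Presentation.dimension])

lemma AlgebraicGeometry.smoothOfRelativeDimension_comp_of_isOpenImmersion (d : ℕ)
    {X Y S : Scheme.{u}} (f : X ⟶ Y) (g : Y ⟶ S) [IsOpenImmersion f]
    [SmoothOfRelativeDimension d g] : SmoothOfRelativeDimension d (f ≫ g) := by
  have := smoothOfRelativeDimension_comp (n := 0) (m := d) f g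
  rwa [zero_add] at this

lemma AlgebraicGeometry.smoothOfRelativeDimension_affineSpaceToBase (d : ℕ) (A : Type u)
    [CommRing A] : SmoothOfRelativeDimension d (affineSpaceToBase d A) := by
  have h := MvPolynomial.isStandardSmoothOfRelativeDimension (A := A) (ULift.{u} (Fin d))
  rw [Nat.card_eq_fintype_card, Fintype.card_ulift, Fintype.card_fin] at h
  have h2 : SmoothOfRelativeDimension d (Spec.map (CommRingCat.ofHom
      (MvPolynomial.C (R := A) (σ := ULift.{u} (Fin d))))) := by
    rw [smoothOfRelativeDimension_Spec_map_iff]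
    refine RingHom.locally_of RingHom.isStandardSmoothOfRelativeDimension_respectsIso _ ?_
    exact (RingHom.isStandardSmoothOfRelativeDimension_algebraMap d).mpr h
  have h3 : affineSpaceToBase d A = (AffineSpace.SpecIso (ULift.{u} (Fin d)) (.of A)).hom ≫
      Spec.map (CommRingCat.ofHom MvPolynomial.C) := by
    rw [← AffineSpace.SpecIso_inv_over, Iso.hom_inv_id_assoc]
  rw [h3]
  exact smoothOfRelativeDimension_comp_of_isOpenImmersion d _ _

end SmoothBasis

/-! ### Shrinking an étale morphism around a section to make it excisive -/

section Excisive

namespace AlgebraicGeometry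

lemma Scheme.Hom.range_eq_preimage_of_injective {X Y Z : Scheme.{u}} (f : X ⟶ Y) (g : Y ⟶ Z)
    (hg : Function.Injective g) : Set.range f = g ⁻¹' Set.range (f ≫ g) := by
  ext y
  constructor
  · rintro ⟨x, rfl⟩
    exact ⟨x, by simp⟩
  · rintro ⟨x, hx⟩
    exact ⟨x, hg (by simpa using hx)⟩

lemma IsClosedImmersion.of_comp_of_isPreimmersion {X Y Z : Scheme.{u}} (f : X ⟶ Y) (g : Y ⟶ Z)
    [IsPreimmersion g] [IsClosedImmersion (f ≫ g)] : IsClosedImmersion f := by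
  have : IsPreimmersion f := .of_comp f g
  refine .of_isPreimmersion f ?_
  rw [f.range_eq_preimage_of_injective g g.isEmbedding.injective]
  exact (f ≫ g).isClosedEmbedding.isClosed_range.preimage g.continuous

lemma range_SpecMap_away {R : CommRingCat.{u}} (r : R) :
    Set.range (Spec.map (CommRingCat.ofHom (algebraMap R (Localization.Away r)))) =
      {p : Spec R | r ∉ PrimeSpectrum.asIdeal p} :=
  PrimeSpectrum.localization_away_comap_range (Localization.Away r) r

lemma range_SpecMap_quotientMk {R : CommRingCat.{u}} (I : Ideal R) :
    Set.range (Spec.map (CommRingCat.ofHom (Ideal.Quotient.mk I))) =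
      {p : Spec R | I ≤ PrimeSpectrum.asIdeal p} := by
  refine (range_comap_of_surjective _ _ Ideal.Quotient.mk_surjective).trans ?_
  rw [Ideal.mk_ker]
  rfl

/-- A closed subscheme of an affine scheme contained in an open has a basic open neighbourhood
inside it. -/
lemma exists_range_subset_range_SpecMap_away {R : CommRingCat.{u}} {X : Scheme.{u}}
    (f : X ⟶ Spec R) [IsClosedImmersion f] (O : Set (Spec R)) (hO : IsOpen O)
    (h : Set.range f ⊆ O) :
    ∃ r : R, Set.range f ⊆
        Set.range (Spec.map (CommRingCat.ofHom (algebraMap R (Localization.Away r)))) ∧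
      Set.range (Spec.map (CommRingCat.ofHom (algebraMap R (Localization.Away r)))) ⊆ O := by
  obtain ⟨I, e, he⟩ := IsClosedImmersion.Spec_iff.mp ‹IsClosedImmersion f›
  have hr : Set.range f = {p : Spec R | I ≤ PrimeSpectrum.asIdeal p} := by
    rw [← range_SpecMap_quotientMk, he]
    simp [Set.range_comp, e.hom.surjective.range_eq]
  obtain ⟨g, hg, hgO⟩ := Ideal.exists_basicOpen_le_of_forall_isMaximal I hO
    fun n _ hle ↦ h (hr.ge hle)
  refine ⟨g, ?_, (range_SpecMap_away g).trans_le hgO⟩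
  rw [range_SpecMap_away, hr]
  intro p (hp : I ≤ PrimeSpectrum.asIdeal p) hgp
  refine (PrimeSpectrum.isPrime p).ne_top ((Ideal.eq_top_iff_one _).mpr ?_)
  simpa using sub_mem hgp (hp hg)

/-- A section of an étale morphism is an open immersion. -/
lemma isOpenImmersion_of_comp_eq_id {X Y : Scheme.{u}} (s : X ⟶ Y) (p : Y ⟶ X) [Etale p]
    (h : s ≫ p = 𝟙 X) : IsOpenImmersion s := by
  have : MorphismProperty.IsStableUnderBaseChange
      (@LocallyOfFiniteType.{u} ⊓ @FormallyUnramified.{u}) :=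
    MorphismProperty.IsStableUnderBaseChange.inf
  -- The diagonal of an unramified morphism locally of finite type is an open immersion, so s
  -- inherits this property from s ≫ p = 𝟙.
  have : MorphismProperty.HasOfPostcompProperty @IsOpenImmersion
      (@LocallyOfFiniteType ⊓ @FormallyUnramified) := by
    rw [MorphismProperty.hasOfPostcompProperty_iff_le_diagonal]
    intro X Y f ⟨hft, hfu⟩
    exact inferInstanceAs <| IsOpenImmersion (pullback.diagonal f)
  refine MorphismProperty.of_postcomp @IsOpenImmersion
    (W' := @LocallyOfFiniteType ⊓ @FormallyUnramified) s p ⟨inferInstance, inferInstance⟩ ?_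
  rw [h]
  infer_instance

/-- An étale morphism from an affine scheme that restricts to a closed immersion on a closed
subscheme is excisive after shrinking. -/
lemma exists_isPullback_of_etale {R : CommRingCat.{u}} {Z U : Scheme.{u}} (k : Z ⟶ Spec R)
    (f : Spec R ⟶ U) [Etale f] [IsClosedImmersion k] [IsClosedImmersion (k ≫ f)] :
    ∃ (r : R) (k' : Z ⟶ Spec (.of (Localization.Away r))),
      k' ≫ Spec.map (CommRingCat.ofHom (algebraMap R (Localization.Away r))) = k ∧
      IsPullback k' (𝟙 Z)
        (Spec.map (CommRingCat.ofHom (algebraMap R (Localization.Away r))) ≫ f) (k ≫ f) := by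
  let s : Z ⟶ pullback f (k ≫ f) := pullback.lift k (𝟙 Z) (by simp)
  have hs1 : s ≫ pullback.fst _ _ = k := pullback.lift_fst _ _ _
  have hs2 : s ≫ pullback.snd _ _ = 𝟙 Z := pullback.lift_snd _ _ _
  have hs : IsOpenImmersion s := isOpenImmersion_of_comp_eq_id s _ hs2
  have hinj : Function.Injective (pullback.fst f (k ≫ f)) :=
    (pullback.fst f (k ≫ f)).isClosedEmbedding.injective
  -- s splits the étale projection f⁻¹(Z) → Z, so its image is open. The rest is closed in f⁻¹(Z),
  -- hence in Spec R, and O discards it while keeping Z.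
  let O : Set (Spec R) := (pullback.fst f (k ≫ f) '' (Set.range s)ᶜ)ᶜ
  have hOo : IsOpen O := ((pullback.fst f (k ≫ f)).isClosedEmbedding.isClosedMap _
    s.isOpenEmbedding.isOpen_range.isClosed_compl).isOpen_compl
  have hO : pullback.fst f (k ≫ f) ⁻¹' O = Set.range s := by
    rw [Set.preimage_compl, Set.preimage_image_eq _ hinj, compl_compl]
  have hkO : Set.range k ⊆ O := by
    rintro _ ⟨z, rfl⟩
    have h1 : s z ∈ pullback.fst f (k ≫ f) ⁻¹' O := hO ▸ ⟨z, rfl⟩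
    rwa [Set.mem_preimage, ← Scheme.Hom.comp_apply, hs1] at h1
  obtain ⟨r, hr, hrO⟩ := exists_range_subset_range_SpecMap_away k O hOo hkO
  set ι := Spec.map (CommRingCat.ofHom (algebraMap R (Localization.Away r)))
  have : IsOpenImmersion ι := inferInstance
  refine ⟨r, IsOpenImmersion.lift ι k hr, IsOpenImmersion.lift_fac _ _ _, ?_⟩
  have hfst : IsPullback (IsOpenImmersion.lift ι k hr) s ι (pullback.fst f (k ≫ f)) := by
    refine IsOpenImmersion.isPullback _ _ _ _ ?_ ?_
    · rw [hs1, IsOpenImmersion.lift_fac]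
    · ext q
      change pullback.fst f (k ≫ f) q ∈ Set.range ι ↔ q ∈ Set.range s
      constructor
      · intro hq
        rw [← hO]
        exact hrO hq
      · rintro ⟨z, rfl⟩
        rw [← Scheme.Hom.comp_apply, hs1]
        exact hr ⟨z, rfl⟩
  have := hfst.paste_vert (IsPullback.of_hasPullback f (k ≫ f))
  rwa [hs2] at this

end AlgebraicGeometry

end Excisive

/-! ### Étale neighbourhoods of finite closed subschemes of smooth affine schemes -/

section SchemeCore

variable {A : Type u} [CommRing A]

lemma encard_setOf_natCard_residueField_eq {S : Type u} [CommRing S] [Algebra A S] {X : Scheme.{u}}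
    (f : X ⟶ Spec (.of S)) [IsPreimmersion f] (m : MaximalSpectrum A) (N : ℕ) :
    {x : X | (f ≫ Spec.map (CommRingCat.ofHom (algebraMap A S))) x = closedPointOf m ∧
      Nat.card (X.residueField x) = N}.encard =
    {p : PrimeSpectrum S | p ∈ Set.range f ∧ p.asIdeal.under A = m.asIdeal ∧
      Nat.card (S ⧸ p.asIdeal) = N}.encard := by
  rw [← f.isEmbedding.injective.encard_image]
  congr 1
  have key (x : X) : ((f ≫ Spec.map (CommRingCat.ofHom (algebraMap A S))) x = closedPointOf m ∧
      Nat.card (X.residueField x) = N) ↔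
      (f x).asIdeal.under A = m.asIdeal ∧ Nat.card (S ⧸ (f x).asIdeal) = N := by
    refine and_congr ?_ ?_
    · rw [Scheme.Hom.comp_apply]
      exact PrimeSpectrum.ext_iff
    · rw [natCard_residueField_of_isPreimmersion f, natCard_residueField_Spec]
  ext p
  constructor
  · rintro ⟨x, hx, rfl⟩
    exact ⟨⟨x, rfl⟩, (key x).mp hx⟩
  · rintro ⟨⟨x, rfl⟩, hx⟩
    exact ⟨x, (key x).mpr hx, rfl⟩

lemma natCard_residueField_closedPointOf (m : MaximalSpectrum A) :
    Nat.card ((Spec (CommRingCat.of A)).residueField (closedPointOf m)) =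
      Nat.card (A ⧸ m.asIdeal) :=
  natCard_residueField_Spec _

/-- Passes from degrees to cardinalities: a finite residue field over k_m has |k_m|^n elements.
Requiring N ≥ 2 forces n ≥ 1 and excludes the value 0 that `Nat.card` gives to infinite fields. -/
lemma NoFiniteFieldObstruction.encard_le {S T : Type u} [CommRing S] [CommRing T] [Algebra A S]
    [Algebra A T] {X Y : Scheme.{u}} (f : X ⟶ Spec (.of S)) (g : Y ⟶ Spec (.of T))
    [IsPreimmersion f] [IsPreimmersion g]
    (h : NoFiniteFieldObstruction (f ≫ Spec.map (CommRingCat.ofHom (algebraMap A S)))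
      (g ≫ Spec.map (CommRingCat.ofHom (algebraMap A T))))
    (m : Ideal A) (hm : m.IsMaximal) (hfin : Finite (A ⧸ m)) (N : ℕ) (hN : 2 ≤ N) :
    {p : PrimeSpectrum S | p ∈ Set.range f ∧ p.asIdeal.under A = m ∧
      Nat.card (S ⧸ p.asIdeal) = N}.encard ≤
    {p : PrimeSpectrum T | p ∈ Set.range g ∧ p.asIdeal.under A = m ∧
      Nat.card (T ⧸ p.asIdeal) = N}.encard := by
  obtain hempty | ⟨p, -, hpm, hpN⟩ := Set.eq_empty_or_nonempty
    {p : PrimeSpectrum S | p ∈ Set.range f ∧ p.asIdeal.under A = m ∧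
      Nat.card (S ⧸ p.asIdeal) = N}
  · rw [hempty, Set.encard_empty]
    exact zero_le
  let m' : MaximalSpectrum A := ⟨m, hm⟩
  have hcard := natCard_residueField_closedPointOf m'
  have : Finite ((Spec (CommRingCat.of A)).residueField (closedPointOf m')) :=
    Nat.finite_of_card_ne_zero (hcard ▸ Nat.card_pos.ne')
  obtain ⟨n, hn⟩ : ∃ n, N = Nat.card (A ⧸ m) ^ n := by
    let : Field (A ⧸ m) := Ideal.Quotient.field m
    have : Finite (S ⧸ p.asIdeal) := Nat.finite_of_card_ne_zero (by lia)
    have : p.asIdeal.LiesOver m := ⟨hpm.symm⟩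
    exact ⟨_, hpN.symm.trans (Module.natCard_eq_pow_finrank (K := A ⧸ m) (V := S ⧸ p.asIdeal))⟩
  have hn1 : 1 ≤ n := by
    rw [Nat.one_le_iff_ne_zero]
    rintro rfl
    simp at hn
    lia
  have := h m' inferInstance n hn1
  rwa [encard_fibrePointsOfDegree _ _ hn1, encard_fibrePointsOfDegree _ _ hn1, hcard, ← hn,
    encard_setOf_natCard_residueField_eq, encard_setOf_natCard_residueField_eq] at this

lemma AlgebraicGeometry.IsClosedImmersion.of_isFinite_of_isPreimmersion {X Y : Scheme.{u}}
    (f : X ⟶ Y) [IsFinite f] [IsPreimmersion f] : IsClosedImmersion f :=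
  .of_isPreimmersion f f.isClosedMap.isClosed_range

lemma AlgebraicGeometry.surjective_of_isClosedImmersion_SpecMap {S T : CommRingCat.{u}} (f : S ⟶ T)
    [IsClosedImmersion (Spec.map f)] : Function.Surjective f := by
  intro t
  obtain ⟨r, hr⟩ := (IsClosedImmersion.isAffine_surjective_of_isAffine (Spec.map f)).2
    ((Scheme.ΓSpecIso T).inv t)
  refine ⟨(Scheme.ΓSpecIso S).hom r, ?_⟩
  have := congr($(Scheme.ΓSpecIso_naturality f) r)
  simp only [CommRingCat.comp_apply] at this
  rw [← this, hr]
  exact congr($((Scheme.ΓSpecIso T).inv_hom_id) t)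

/-- The main construction for `Spec (R ⧸ I)` in `Spec R`, mapping to an open subscheme of affine
space. -/
theorem exists_etale_of_noFiniteFieldObstruction {R σ : Type u} [CommRing R] [Algebra A R]
    [Finite σ] [Nonempty σ] [Finite (MaximalSpectrum A)]
    (hR : SmoothOfRelativeDimension (Nat.card σ) (Spec.map (CommRingCat.ofHom (algebraMap A R))))
    {V : Scheme.{u}} (v : V ⟶ Spec (.of (MvPolynomial σ A))) [IsOpenImmersion v]
    (hV : Surjective (v ≫ Spec.map (CommRingCat.ofHom (algebraMap A (MvPolynomial σ A)))))
    (I J : Ideal R) (hIJ : I ≤ J) [Module.Finite A (R ⧸ I)]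
    (hobs : NoFiniteFieldObstruction
      (Spec.map (CommRingCat.ofHom (Ideal.Quotient.mk I)) ≫
        Spec.map (CommRingCat.ofHom (algebraMap A R)))
      (v ≫ Spec.map (CommRingCat.ofHom (algebraMap A (MvPolynomial σ A)))))
    (ιY : Spec (.of (R ⧸ J)) ⟶ V) [IsClosedImmersion ιY]
    (hιY : ιY ≫ v ≫ Spec.map (CommRingCat.ofHom (algebraMap A (MvPolynomial σ A))) =
      Spec.map (CommRingCat.ofHom (algebraMap A (R ⧸ J)))) :
    ∃ (g : R) (k : Spec (.of (R ⧸ I)) ⟶ Spec (.of (Localization.Away g)))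
      (f : Spec (.of (Localization.Away g)) ⟶ V),
      k ≫ Spec.map (CommRingCat.ofHom (algebraMap R (Localization.Away g))) =
        Spec.map (CommRingCat.ofHom (Ideal.Quotient.mk I)) ∧ Etale f ∧
      f ≫ v ≫ Spec.map (CommRingCat.ofHom (algebraMap A (MvPolynomial σ A))) =
        Spec.map (CommRingCat.ofHom (algebraMap R (Localization.Away g))) ≫
          Spec.map (CommRingCat.ofHom (algebraMap A R)) ∧
      IsClosedImmersion (k ≫ f) ∧
      Spec.map (CommRingCat.ofHom (Ideal.Quotient.factor hIJ)) ≫ k ≫ f = ιY := by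
  have hsm : Algebra.Smooth A R := by
    have := SmoothOfRelativeDimension.smooth (Nat.card σ) (Spec.map (CommRingCat.ofHom (algebraMap A R)))
    have := (HasRingHomProperty.Spec_iff (P := @Smooth)).mp this
    exact (RingHom.smooth_algebraMap).mp this
  have : Module.Finite A (R ⧸ J) :=
    .of_surjective (Ideal.Quotient.factorₐ A hIJ).toLinearMap (Ideal.Quotient.factor_surjective hIJ)
  -- the given embedding, in terms of coordinates
  let y₀ : CommRingCat.of (MvPolynomial σ A) ⟶ .of (R ⧸ J) := Spec.preimage (ιY ≫ v)
  have hy₀ : Spec.map y₀ = ιY ≫ v := Spec.map_preimage _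
  have hyA : CommRingCat.ofHom (algebraMap A (MvPolynomial σ A)) ≫ y₀ =
      CommRingCat.ofHom (algebraMap A (R ⧸ J)) := by
    apply Spec.map_injective
    rw [Spec.map_comp, hy₀, Category.assoc, hιY]
  let y : MvPolynomial σ A →ₐ[A] R ⧸ J :=
    { y₀.hom with commutes' := fun a ↦ congr($(hyA).hom a) }
  have hysurj : Function.Surjective y := by
    -- A closed subscheme of V need not be closed in affine space. This one is, because it is finite
    -- over A.
    have hfin : IsFinite (Spec.map (CommRingCat.ofHom (algebraMap A (R ⧸ J)))) :=
      (IsFinite.SpecMap_iff _).mpr (RingHom.finite_algebraMap.mpr inferInstance)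
    have : IsFinite (Spec.map y₀) := by
      have : IsFinite (Spec.map y₀ ≫
          Spec.map (CommRingCat.ofHom (algebraMap A (MvPolynomial σ A)))) := by
        rwa [hy₀, Category.assoc, hιY]
      exact .of_comp _ (Spec.map (CommRingCat.ofHom (algebraMap A (MvPolynomial σ A))))
    have : IsPreimmersion (Spec.map y₀) := hy₀ ▸ inferInstance
    have := IsClosedImmersion.of_isFinite_of_isPreimmersion (Spec.map y₀)
    exact surjective_of_isClosedImmersion_SpecMap y₀
  let U : TopologicalSpace.Opens (PrimeSpectrum (MvPolynomial σ A)) := v.opensRange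
  have hU (m : Ideal A) (hm : m.IsMaximal) : ∃ x ∈ U, x.asIdeal.under A = m := by
    obtain ⟨x, hx⟩ := hV.surj (closedPointOf ⟨m, hm⟩)
    exact ⟨v x, ⟨x, rfl⟩, congr(PrimeSpectrum.asIdeal $hx)⟩
  have hyU (q : PrimeSpectrum (R ⧸ J)) : PrimeSpectrum.comap y.toRingHom q ∈ U :=
    ⟨ιY q, congr($(hy₀.symm) q)⟩
  obtain ⟨φ, g, hφy, hφI, hg, hgU, het⟩ := exists_aeval_surjective_and_etale U hU I J
    (fun n _ _ ↦ KaehlerDifferential.nonempty_basis_localization_of_locally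
      ((smoothOfRelativeDimension_Spec_map_iff _ _).mp hR) n)
    (fun m hm hfin N hN ↦ by
      have := IsClosedImmersion.spec_of_quotient_mk (R := .of R) I
      have := hobs.encard_le _ v m hm hfin N hN
      rw [range_SpecMap_quotientMk (R := .of R)] at this
      exact this) y hysurj hyU
  let F : Spec (.of (Localization.Away g)) ⟶ Spec (.of (MvPolynomial σ A)) :=
    Spec.map (CommRingCat.ofHom (algebraMap R (Localization.Away g))) ≫
      Spec.map (CommRingCat.ofHom φ.toRingHom)
  have hF : Etale F := by
    change Etale (Spec.map _ ≫ Spec.map _)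
    rw [← Spec.map_comp]
    exact (HasRingHomProperty.Spec_iff (P := @Etale)).mpr het
  have hFv : Set.range F ⊆ Set.range v := by
    rintro _ ⟨x, rfl⟩
    rw [Scheme.Hom.comp_apply]
    refine hgU _ ?_
    exact (range_SpecMap_away (R := .of R) g).le ⟨x, rfl⟩
  let f := IsOpenImmersion.lift v F hFv
  have hfv : f ≫ v = F := IsOpenImmersion.lift_fac _ _ _
  have hf : Etale f := by
    have : Etale (f ≫ v) := hfv ▸ hF
    exact .of_comp f v
  have hrange : Set.range (Spec.map (CommRingCat.ofHom (Ideal.Quotient.mk I))) ⊆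
      Set.range (Spec.map (CommRingCat.ofHom (algebraMap R (Localization.Away g)))) := by
    rw [range_SpecMap_away (R := .of R), range_SpecMap_quotientMk (R := .of R)]
    intro p (hp : I ≤ PrimeSpectrum.asIdeal p) hgp
    refine (PrimeSpectrum.isPrime p).ne_top ((Ideal.eq_top_iff_one _).mpr ?_)
    simpa using sub_mem hgp (hp hg)
  have : IsOpenImmersion (Spec.map (CommRingCat.ofHom (algebraMap R (Localization.Away g)))) :=
    inferInstance
  let k := IsOpenImmersion.lift (Spec.map (CommRingCat.ofHom (algebraMap R (Localization.Away g))))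
    (Spec.map (CommRingCat.ofHom (Ideal.Quotient.mk I))) hrange
  have hk : k ≫ Spec.map (CommRingCat.ofHom (algebraMap R (Localization.Away g))) =
      Spec.map (CommRingCat.ofHom (Ideal.Quotient.mk I)) := IsOpenImmersion.lift_fac _ _ _
  have hkf : (k ≫ f) ≫ v =
      Spec.map (CommRingCat.ofHom ((Ideal.Quotient.mkₐ A I).comp φ).toRingHom) := by
    rw [Category.assoc, hfv, reassoc_of% hk, ← Spec.map_comp]
    rfl
  refine ⟨g, k, f, hk, hf, ?_, ?_, ?_⟩
  · rw [reassoc_of% hfv, Category.assoc]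
    congr 1
    rw [← Spec.map_comp, ← CommRingCat.ofHom_comp]
    exact congr(Spec.map (CommRingCat.ofHom $(φ.comp_algebraMap)))
  · have : IsClosedImmersion ((k ≫ f) ≫ v) := hkf ▸ IsClosedImmersion.spec_of_surjective _ hφI
    exact .of_comp_of_isPreimmersion _ v
  · rw [← cancel_mono v, Category.assoc, hkf, ← hy₀, ← Spec.map_comp]
    exact congr(Spec.map (CommRingCat.ofHom (AlgHom.toRingHom $hφy)))

end SchemeCore

/-! ### Assembling the excisive embedding and the criterion -/

section Main

variable {A : Type u} [CommRing A]

lemma NoFiniteFieldObstruction.trans {X Y Z : Scheme.{u}} {x : X ⟶ Spec (CommRingCat.of A)}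
    {y : Y ⟶ Spec (CommRingCat.of A)} {z : Z ⟶ Spec (CommRingCat.of A)}
    (h : NoFiniteFieldObstruction x y) (h' : NoFiniteFieldObstruction y z) :
    NoFiniteFieldObstruction x z :=
  fun m hm n hn ↦ (h m hm n hn).trans (h' m hm n hn)

/-- The excisive embedding for a finite closed subscheme of a smooth affine `Spec R`. -/
theorem exists_excisive_of_noFiniteFieldObstruction {R σ : Type u} [CommRing R] [Algebra A R]
    [Finite σ] [Nonempty σ] [Finite (MaximalSpectrum A)]
    (hR : SmoothOfRelativeDimension (Nat.card σ) (Spec.map (CommRingCat.ofHom (algebraMap A R))))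
    {V : Scheme.{u}} (v : V ⟶ Spec (.of (MvPolynomial σ A))) [IsOpenImmersion v]
    (hV : Surjective (v ≫ Spec.map (CommRingCat.ofHom (algebraMap A (MvPolynomial σ A)))))
    {Z : Scheme.{u}} (j : Z ⟶ Spec (.of R)) [IsClosedImmersion j]
    [hfin : IsFinite (j ≫ Spec.map (CommRingCat.ofHom (algebraMap A R)))]
    (hobs : NoFiniteFieldObstruction (j ≫ Spec.map (CommRingCat.ofHom (algebraMap A R)))
      (v ≫ Spec.map (CommRingCat.ofHom (algebraMap A (MvPolynomial σ A)))))
    {Y : Scheme.{u}} (i : Y ⟶ Z) [IsClosedImmersion i] (ιY : Y ⟶ V) [IsClosedImmersion ιY]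
    (hιY : ιY ≫ v ≫ Spec.map (CommRingCat.ofHom (algebraMap A (MvPolynomial σ A))) =
      i ≫ j ≫ Spec.map (CommRingCat.ofHom (algebraMap A R))) :
    ∃ (D : Scheme.{u}) (u : D ⟶ Spec (.of R)) (k : Z ⟶ D) (f : D ⟶ V),
      IsAffine D ∧ IsOpenImmersion u ∧ k ≫ u = j ∧ Etale f ∧
      f ≫ v ≫ Spec.map (CommRingCat.ofHom (algebraMap A (MvPolynomial σ A))) =
        u ≫ Spec.map (CommRingCat.ofHom (algebraMap A R)) ∧
      IsClosedImmersion (k ≫ f) ∧ IsPullback k (𝟙 Z) f (k ≫ f) ∧ i ≫ k ≫ f = ιY := by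
  obtain ⟨I, eZ, hI⟩ := IsClosedImmersion.Spec_iff.mp (inferInstance : IsClosedImmersion j)
  obtain ⟨J, eY, hJ⟩ := IsClosedImmersion.Spec_iff.mp (inferInstance : IsClosedImmersion (i ≫ j))
  have hI' : eZ.inv ≫ j = Spec.map (CommRingCat.ofHom (Ideal.Quotient.mk I)) := by
    rw [hI, Iso.inv_hom_id_assoc]
  have hJ' : eY.inv ≫ i ≫ j = Spec.map (CommRingCat.ofHom (Ideal.Quotient.mk J)) := by
    rw [hJ, Iso.inv_hom_id_assoc]
  have hmk : Spec.map (Spec.preimage (eY.inv ≫ i ≫ eZ.hom)) ≫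
      Spec.map (CommRingCat.ofHom (Ideal.Quotient.mk I)) =
        Spec.map (CommRingCat.ofHom (Ideal.Quotient.mk J)) := by
    rw [Spec.map_preimage, ← hI', ← hJ']
    simp
  have hIJ : I ≤ J := by
    intro r hr
    rw [← Spec.map_comp] at hmk
    have := congr($(Spec.map_injective hmk).hom r)
    rw [← Ideal.Quotient.eq_zero_iff_mem]
    refine this.symm.trans ?_
    change (Spec.preimage (eY.inv ≫ i ≫ eZ.hom)).hom (Ideal.Quotient.mk I r) = 0
    rw [Ideal.Quotient.eq_zero_iff_mem.mpr hr, map_zero]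
  have hfactor : Spec.map (CommRingCat.ofHom (Ideal.Quotient.factor hIJ)) =
      eY.inv ≫ i ≫ eZ.hom := by
    have := IsClosedImmersion.spec_of_quotient_mk (R := .of R) I
    rw [← cancel_mono (Spec.map (CommRingCat.ofHom (Ideal.Quotient.mk I))),
      ← Spec.map_preimage (eY.inv ≫ i ≫ eZ.hom), hmk, ← Spec.map_comp]
    rfl
  have hquot (K : Ideal R) : Spec.map (CommRingCat.ofHom (Ideal.Quotient.mk K)) ≫
      Spec.map (CommRingCat.ofHom (algebraMap A R)) =
        Spec.map (CommRingCat.ofHom (algebraMap A (R ⧸ K))) := by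
    rw [← Spec.map_comp]
    rfl
  have : Module.Finite A (R ⧸ I) := by
    have h : IsFinite (eZ.inv ≫ j ≫ Spec.map (CommRingCat.ofHom (algebraMap A R))) := inferInstance
    rw [reassoc_of% hI', hquot, IsFinite.SpecMap_iff] at h
    exact RingHom.finite_algebraMap.mp h
  have hobs' : NoFiniteFieldObstruction (Spec.map (CommRingCat.ofHom (Ideal.Quotient.mk I)) ≫
      Spec.map (CommRingCat.ofHom (algebraMap A R)))
      (v ≫ Spec.map (CommRingCat.ofHom (algebraMap A (MvPolynomial σ A)))) := by
    rw [← hI', Category.assoc]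
    exact (NoFiniteFieldObstruction.of_isPreimmersion eZ.inv _).trans hobs
  obtain ⟨g, k₀, f₀, hk₀, hf₀, hover, hcl, hY⟩ := exists_etale_of_noFiniteFieldObstruction hR v hV
    I J hIJ hobs' (eY.inv ≫ ιY) (by
      rw [Category.assoc, hιY, ← hquot J, ← hJ']
      simp only [Category.assoc])
  have hk : (eZ.hom ≫ k₀) ≫ Spec.map (CommRingCat.ofHom (algebraMap R (Localization.Away g))) =
      j := by
    rw [Category.assoc, hk₀, hI]
  have hop : IsOpenImmersion
      (Spec.map (CommRingCat.ofHom (algebraMap R (Localization.Away g)))) := inferInstance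
  have : IsClosedImmersion (eZ.hom ≫ k₀) := by
    have : IsClosedImmersion ((eZ.hom ≫ k₀) ≫
      Spec.map (CommRingCat.ofHom (algebraMap R (Localization.Away g)))) := hk ▸ inferInstance
    exact .of_comp_of_isPreimmersion _
      (Spec.map (CommRingCat.ofHom (algebraMap R (Localization.Away g))))
  have : IsClosedImmersion ((eZ.hom ≫ k₀) ≫ f₀) := by
    rw [Category.assoc]
    infer_instance
  -- A second shrinking: the first made f étale with image in V, and this one makes Z the full
  -- preimage of its image.
  obtain ⟨r, k, hkr, hpb⟩ := exists_isPullback_of_etale (R := .of (Localization.Away g))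
    (eZ.hom ≫ k₀) f₀
  set u₁ := Spec.map (CommRingCat.ofHom
    (algebraMap (CommRingCat.of (Localization.Away g)) (Localization.Away r)))
  have hu₁ : IsOpenImmersion u₁ := inferInstance
  have hkf : k ≫ u₁ ≫ f₀ = (eZ.hom ≫ k₀) ≫ f₀ := by rw [reassoc_of% hkr, Category.assoc]
  refine ⟨_, u₁ ≫ Spec.map (CommRingCat.ofHom (algebraMap R (Localization.Away g))), k, u₁ ≫ f₀,
    inferInstance, inferInstance, ?_, inferInstance, ?_, ?_, ?_, ?_⟩
  · rw [reassoc_of% hkr, ← hk, Category.assoc]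
  · rw [Category.assoc, hover, Category.assoc]
  · rwa [hkf]
  · rwa [hkf]
  · rw [hkf, ← cancel_epi eY.inv, ← hY, hfactor]
    simp only [Category.assoc]

/-- An open of affine space is an open subscheme of the spectrum of a polynomial ring. -/
lemma AffineSpace.exists_isOpenImmersion_Spec_mvPolynomial {d : ℕ}
    (U : (affineSpaceOver d A).Opens) :
    ∃ v : U.toScheme ⟶ Spec (.of (MvPolynomial (ULift.{u} (Fin d)) A)), IsOpenImmersion v ∧
      v ≫ Spec.map (CommRingCat.ofHom (algebraMap A (MvPolynomial (ULift.{u} (Fin d)) A))) =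
        openToBase U := by
  refine ⟨U.ι ≫ (AffineSpace.SpecIso (ULift.{u} (Fin d)) (.of A)).hom, inferInstance, ?_⟩
  rw [Category.assoc]
  congr 1
  rw [← Iso.eq_inv_comp]
  exact (AffineSpace.SpecIso_inv_over (n := ULift.{u} (Fin d)) (.of A)).symm

theorem exists_isExcisiveEmbedding [Finite (MaximalSpectrum A)] {d : ℕ} (hd : 0 < d)
    (U : (affineSpaceOver d A).Opens) (hU : Surjective (openToBase U)) {Z : Scheme.{u}}
    (z : Z ⟶ Spec (CommRingCat.of A)) [IsFinite z]
    (hobs : NoFiniteFieldObstruction z (openToBase U)) (C : Scheme.{u})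
    (c : C ⟶ Spec (CommRingCat.of A)) (j : Z ⟶ C) [IsAffine C] [SmoothOfRelativeDimension d c]
    [IsClosedImmersion j] (hj : j ≫ c = z) (Y : Scheme.{u}) (i : Y ⟶ Z) (ιY : Y ⟶ U.toScheme)
    [IsClosedImmersion i] [IsClosedImmersion ιY] (hιY : ιY ≫ openToBase U = i ≫ z) :
    ∃ (D : C.Opens) (k : Z ⟶ D.toScheme) (f : D.toScheme ⟶ U.toScheme),
      IsAffineOpen D ∧ Etale f ∧ f ≫ openToBase U = D.ι ≫ c ∧
        IsExcisiveEmbedding j D k f ∧ i ≫ k ≫ f = ιY := by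
  obtain ⟨v, hv, hvU⟩ := AffineSpace.exists_isOpenImmersion_Spec_mvPolynomial U
  have hcard : Nat.card (ULift.{u} (Fin d)) = d := by simp
  have : Nonempty (ULift.{u} (Fin d)) := ⟨⟨⟨0, hd⟩⟩⟩
  let e : C ≅ Spec (.of Γ(C, ⊤)) := C.isoSpec
  let ψ : CommRingCat.of A ⟶ .of Γ(C, ⊤) := Spec.preimage (e.inv ≫ c)
  let : Algebra A Γ(C, ⊤) := ψ.hom.toAlgebra
  have hψ : Spec.map (CommRingCat.ofHom (algebraMap A Γ(C, ⊤))) = e.inv ≫ c :=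
    Spec.map_preimage (e.inv ≫ c)
  have hje : (j ≫ e.hom) ≫ Spec.map (CommRingCat.ofHom (algebraMap A Γ(C, ⊤))) = z := by
    rw [hψ, Category.assoc, Iso.hom_inv_id_assoc, hj]
  have : IsFinite ((j ≫ e.hom) ≫ Spec.map (CommRingCat.ofHom (algebraMap A Γ(C, ⊤)))) := by
    rwa [hje]
  obtain ⟨D, u, k, f, hD, hu, hku, hf, hover, hcl, hpb, hY⟩ :=
    exists_excisive_of_noFiniteFieldObstruction (R := Γ(C, ⊤)) (σ := ULift.{u} (Fin d))
      (by
        rw [hcard, hψ]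
        exact smoothOfRelativeDimension_comp_of_isOpenImmersion d _ _) v (by rwa [hvU])
      (j ≫ e.hom) (by rwa [hje, hvU]) i ιY (by rwa [hvU, hje])
  have hop : IsOpenImmersion (u ≫ e.inv) := inferInstance
  let w := (u ≫ e.inv).isoOpensRange
  have hw : w.hom ≫ (u ≫ e.inv).opensRange.ι = u ≫ e.inv :=
    (u ≫ e.inv).isoOpensRange_hom_ι
  refine ⟨(u ≫ e.inv).opensRange, k ≫ w.hom, w.inv ≫ f, isAffineOpen_opensRange _, inferInstance,
    ?_, ⟨?_, Z, k ≫ f, Iso.refl Z, hcl, ?_⟩, ?_⟩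
  · rw [Category.assoc, Iso.inv_comp_eq, reassoc_of% hw, ← hvU, hover, hψ]
  · rw [Category.assoc, hw, reassoc_of% hku, Iso.hom_inv_id, Category.comp_id]
  · exact IsPullback.of_iso hpb (Iso.refl _) w (Iso.refl _) (Iso.refl _)
      (by simp) (by simp) (by simp) (by simp)
  · simpa using hY

/-- A finite closed subscheme of an open of affine space is closed in a smooth affine scheme. -/
lemma exists_isAffine_smoothOfRelativeDimension {d : ℕ} (U : (affineSpaceOver d A).Opens)
    {Z : Scheme.{u}} (z : Z ⟶ Spec (CommRingCat.of A)) [hz : IsFinite z] (ι : Z ⟶ U.toScheme)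
    [IsClosedImmersion ι] (hι : ι ≫ openToBase U = z) :
    ∃ (C : Scheme.{u}) (c : C ⟶ Spec (CommRingCat.of A)) (j : Z ⟶ C),
      IsAffine C ∧ SmoothOfRelativeDimension d c ∧ IsClosedImmersion j ∧ j ≫ c = z := by
  obtain ⟨v, hv, hvU⟩ := AffineSpace.exists_isOpenImmersion_Spec_mvPolynomial U
  have hfin : IsFinite (ι ≫ v) := by
    have : IsFinite ((ι ≫ v) ≫ Spec.map
        (CommRingCat.ofHom (algebraMap A (MvPolynomial (ULift.{u} (Fin d)) A)))) := by
      rwa [Category.assoc, hvU, hι]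
    exact .of_comp _ (Spec.map
      (CommRingCat.ofHom (algebraMap A (MvPolynomial (ULift.{u} (Fin d)) A))))
  have hcl : IsClosedImmersion (ι ≫ v) := .of_isFinite_of_isPreimmersion _
  -- U itself need not be affine, so C is taken to be a basic open of affine space between Z and U.
  obtain ⟨r, hr, hrv⟩ := exists_range_subset_range_SpecMap_away (ι ≫ v) (Set.range v)
    v.isOpenEmbedding.isOpen_range (by
      rintro _ ⟨x, rfl⟩
      exact ⟨ι x, by simp⟩)
  set b := Spec.map (CommRingCat.ofHom
    (algebraMap (CommRingCat.of (MvPolynomial (ULift.{u} (Fin d)) A)) (Localization.Away r)))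
  have hb : IsOpenImmersion b := inferInstance
  let j := IsOpenImmersion.lift b (ι ≫ v) hr
  have hjb : j ≫ b = ι ≫ v := IsOpenImmersion.lift_fac _ _ _
  let l := IsOpenImmersion.lift v b hrv
  have hl : l ≫ v = b := IsOpenImmersion.lift_fac _ _ _
  have hlo : IsOpenImmersion l := by
    have : IsOpenImmersion (l ≫ v) := hl ▸ hb
    exact .of_comp l v
  have hjl : j ≫ l = ι := by
    rw [← cancel_mono v, Category.assoc, hl, hjb]
  have := smoothOfRelativeDimension_affineSpaceToBase d A
  refine ⟨_, (l ≫ U.ι) ≫ affineSpaceToBase d A, j, inferInstance,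
    smoothOfRelativeDimension_comp_of_isOpenImmersion d _ _, ?_, ?_⟩
  · have : IsClosedImmersion (j ≫ l) := hjl ▸ inferInstance
    exact .of_comp_of_isPreimmersion j l
  · rw [Category.assoc, reassoc_of% hjl, ← hι]

theorem mainTheorem12 {A : Type u} [CommRing A] [Finite (MaximalSpectrum A)]
    (d : ℕ) (hd : 0 < d) (U : (affineSpaceOver d A).Opens)
    -- every fibre of `U` over `Spec A` is nonempty
    (hU : Surjective (openToBase U))
    {Z : Scheme.{u}} (z : Z ⟶ Spec (CommRingCat.of A)) (hz : IsFinite z) :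
    -- (a) the criterion for `Z` to embed into `U`
    ((∃ ι : Z ⟶ U.toScheme, IsClosedImmersion ι ∧ ι ≫ openToBase U = z) ↔
      NoFiniteFieldObstruction z (openToBase U) ∧
        ∃ (C : Scheme.{u}) (c : C ⟶ Spec (CommRingCat.of A)) (j : Z ⟶ C),
          IsAffine C ∧ SmoothOfRelativeDimension d c ∧ IsClosedImmersion j ∧ j ≫ c = z) ∧
    -- (b) for any such `C`, the embedding may be chosen excisive,
    -- also extending a given embedding of a closed subscheme
    (NoFiniteFieldObstruction z (openToBase U) →
      ∀ (C : Scheme.{u}) (c : C ⟶ Spec (CommRingCat.of A)) (j : Z ⟶ C),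
        IsAffine C → SmoothOfRelativeDimension d c → IsClosedImmersion j → j ≫ c = z →
        (∃ (D : C.Opens) (k : Z ⟶ D.toScheme) (f : D.toScheme ⟶ U.toScheme),
          IsAffineOpen D ∧ Etale f ∧ f ≫ openToBase U = D.ι ≫ c ∧
            IsExcisiveEmbedding j D k f) ∧
        ∀ (Y : Scheme.{u}) (i : Y ⟶ Z) (ιY : Y ⟶ U.toScheme),
          IsClosedImmersion i → IsClosedImmersion ιY → ιY ≫ openToBase U = i ≫ z →
          ∃ (D : C.Opens) (k : Z ⟶ D.toScheme) (f : D.toScheme ⟶ U.toScheme),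
            IsAffineOpen D ∧ Etale f ∧ f ≫ openToBase U = D.ι ≫ c ∧
              IsExcisiveEmbedding j D k f ∧ i ≫ k ≫ f = ιY) := by
  have key (hobs : NoFiniteFieldObstruction z (openToBase U)) (C : Scheme.{u})
      (c : C ⟶ Spec (CommRingCat.of A)) (j : Z ⟶ C) (_ : IsAffine C)
      (_ : SmoothOfRelativeDimension d c) (_ : IsClosedImmersion j) (hj : j ≫ c = z) :
      ∃ (D : C.Opens) (k : Z ⟶ D.toScheme) (f : D.toScheme ⟶ U.toScheme),
        IsAffineOpen D ∧ Etale f ∧ f ≫ openToBase U = D.ι ≫ c ∧ IsExcisiveEmbedding j D k f := by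
    -- Without a prescribed restriction, Y is taken to be the empty scheme.
    obtain ⟨D, k, f, hD, hf, hover, hex, -⟩ := exists_isExcisiveEmbedding hd U hU z hobs C c j hj
      (⊥_ Scheme.{u}) (initial.to Z) (initial.to U.toScheme) (initial.hom_ext _ _)
    exact ⟨D, k, f, hD, hf, hover, hex⟩
  refine ⟨⟨?_, ?_⟩, fun hobs C c j hC hc hj hjz ↦ ⟨key hobs C c j hC hc hj hjz, ?_⟩⟩
  · rintro ⟨ι, hι, hιz⟩
    exact ⟨hιz ▸ .of_isPreimmersion ι _, exists_isAffine_smoothOfRelativeDimension U z ι hιz⟩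
  · rintro ⟨hobs, C, c, j, hC, hc, hj, hjz⟩
    obtain ⟨D, k, f, -, -, hover, hkj, Z', i', e, hi', hpb⟩ := key hobs C c j hC hc hj hjz
    refine ⟨k ≫ f, ?_, ?_⟩
    · rw [hpb.w]
      infer_instance
    · rw [Category.assoc, hover, reassoc_of% hkj, hjz]
  · intro Y i ιY hi hιY hY
    exact exists_isExcisiveEmbedding hd U hU z hobs C c j hjz Y i ιY hY

end Main
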